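/- Let $d\ge 1$ and let $X_1,\dots,X_n$ be i.i.d. with an unknown probability density $f$ on $\mathbb R^d$. An estimator $\widehat N_n$ of $\|f\|_2$ is a measurable real function of $(X_1,\dots,X_n)$; for a set $\mathbb F$ of densities put $\mathcal R_n[\widehat N_n;\mathbb F]=\sup_{f\in\mathbb F}\big(\mathbb E_f[\widehat N_n-\|f\|_2]^2\big)^{1/2}$. For $\theta=(\beta,r)$ with $\beta>0$, $r\in[1,\infty]$, and $L,Q>0$, let $\mathbb N_{\theta,L,Q}$ be the set of probability densities $f$ with $\|f\|_\infty\le Q$ that belong to the isotropic Nikolskii class $\mathbb N_{r,d}(\beta,L)$, i.e. $\|f\|_r\le L$ and there are natural numbers $k_1,\dots,k_d>\beta$ such that $\|\Delta^{k_j}_{u,j}f\|_r\le L|u|^{\beta}$ for all $u\in\mathbb R$ and $j=1,\dots,d$, where $\Delta_{u,j}f(x)=f(x+ue_j)-f(x)$. For $b\in(0,\infty]$ let $\Theta^b$ be the set of $\theta=(\beta,r)$, $0<\beta\le b$ ($\beta<\infty$), $r\in[1,\infty]$, such that either $r\ge 2$ and $\beta r<d(r-1)$, or $r<2$ and $\beta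 r<d$ (for $r=\infty$ the condition reads $\beta<d$), with the single point $\theta=(b,2)$ left out (it satisfies these conditions only if $b<d/2$). For $\theta\in\Theta^b$ let $z^*(\theta)=\frac{\beta r}{\beta r+d(r-1)}$ if $r\ge2$ (equal to $\frac{\beta}{\beta+d}$ if $r=\infty$), $z^*(\theta)=\frac{\beta r}{\beta r+d}$ if $r<2$, and $\psi^*_n(\theta)=\big(\sqrt{\ln n}/n\big)^{z^*(\theta)}$. A family $\mathcal M=\{\mu_n(\theta),\theta\in\Theta^b\}$ of normalizations (positive for all large $n$) is called admissible if there is a single estimator $\widehat N_n$ with $\limsup_{n\to\infty}\mu_n(\theta)^{-1}\mathcal R_n[\widehat N_n;\mathbb N_{\theta,L,Q}]<\infty$ for all $\theta\in\Theta^b$ and $L,Q>0$. For two families put $\Theta_-(\Psi,\mathcal M)=\{\theta\in\Theta^b:\lim_{n\to\infty}\psi_n(\theta)/\mu_n(\theta)=\infty\}$. Theorem. For every $b\in(0,\infty]$ such that $\Psi^b=\{\psi_n^*(\theta),\theta\in\Theta^b\}$ is admissible, $\Psi^b$ is the adaptive rate of convergence over $\{\mathbb N_{\theta,L,Q}:\theta\in\Theta^b,\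 L,Q>0\}$, that is: (i) $\Psi^b$ is admissible; (ii) for every admissible family $\mathcal M$ the set $\Theta_-(\Psi^b,\mathcal M)$ is contained in a one-dimensional topological manifold (possibly with boundary, not necessarily connected) $\mathbb T\subset\Theta^b$; (iii) for every admissible $\mathcal M$ and every $\theta\in\Theta_-(\Psi^b,\mathcal M)$ there is a set $\Theta[\theta]\subset\Theta^b$ containing a Euclidean ball of $\mathbb R^2$ such that $\lim_{n\to\infty}\frac{\psi^*_n(\theta^*)}{\mu_n(\theta^*)}\,\frac{\psi^*_n(\theta)}{\mu_n(\theta)}=0$ for all $\theta^*\in\Theta[\theta]$. -/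

import Mathlib

open MeasureTheory Filter Topology
open scoped ENNReal

noncomputable section

namespace L2NormEstimation

/-! ## Norms, densities and Nikolskii classes on `ℝ^d` -/

/-- The `𝕃_p`-norm with respect to Lebesgue measure on `ℝ^d`, with values in `[0, ∞]`;
for `p = ∞` it is the supremum of `|f|` over all points. -/
def normLp {d : ℕ} (p : ℝ≥0∞) (f : (Fin d → ℝ) → ℝ) : ℝ≥0∞ :=
  if p = ∞ then ⨆ x, ENNReal.ofReal |f x| else eLpNorm f p volume

/-- A probability density with respect to Lebesgue measure on `ℝ^d`. -/
structure IsDensity {d : ℕ} (f : (Fin d → ℝ) → ℝ) : Prop where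
  measurable : Measurable f
  nonneg : ∀ x, 0 ≤ f x
  lintegral_eq_one : ∫⁻ x, ENNReal.ofReal (f x) = 1

/-- First order difference with step `u` in the direction of the `j`-th variable.
The difference of order `k` is its `k`-th iterate. -/
def diffOp {d : ℕ} (u : ℝ) (j : Fin d) (G : (Fin d → ℝ) → ℝ) : (Fin d → ℝ) → ℝ :=
  fun x => G (x + u • Pi.single j (1 : ℝ)) - G x

/-- The anisotropic Nikolskii class with smoothness `β`, integrability `r` and radius `L`. -/
def nikolskii {d : ℕ} (r : Fin d → ℝ≥0∞) (β L : Fin d → ℝ) : Set ((Fin d → ℝ) → ℝ) :=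
  {G | (∀ j, normLp (r j) G ≤ ENNReal.ofReal (L j)) ∧
    ∃ k : Fin d → ℕ, (∀ j, β j < (k j : ℝ)) ∧
      ∀ (u : ℝ) (j : Fin d),
        normLp (r j) ((diffOp u j)^[k j] G) ≤ ENNReal.ofReal (L j * |u| ^ β j)}

/-- The parameters `θ = (β, r)` which determine the rate of convergence. -/
abbrev RateParam : Type := ℝ × ℝ≥0∞

/-- The probability densities in the isotropic Nikolskii class with parameters `θ = (β, r)` and
`L` that are bounded by `Q`. -/
def boundedClass (d : ℕ) (θ : RateParam) (L Q : ℝ) : Set ((Fin d → ℝ) → ℝ) :=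
  {f | IsDensity f ∧ f ∈ nikolskii (fun _ => θ.2) (fun _ => θ.1) (fun _ => L) ∧
    normLp ∞ f ≤ ENNReal.ofReal Q}

/-! ## Observations, estimators and risks -/

/-- The law of `n` independent observations with density `f`: its density with respect to
Lebesgue measure on `(ℝ^d)^n` is `∏ i, f (x i)`. -/
def sampleLaw {d : ℕ} (f : (Fin d → ℝ) → ℝ) (n : ℕ) : Measure (Fin n → Fin d → ℝ) :=
  volume.withDensity fun x => ENNReal.ofReal (∏ i, f (x i))

/-- A sequence of estimators: for every sample size `n`, a measurable real function of the
sample. -/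
structure Estimator (d : ℕ) where
  toFun : (n : ℕ) → (Fin n → Fin d → ℝ) → ℝ
  measurable : ∀ n, Measurable (toFun n)

/-- Quadratic risk of an estimator of the `𝕃_2`-norm at the density `f`. -/
def risk {d : ℕ} (N : Estimator d) (n : ℕ) (f : (Fin d → ℝ) → ℝ) : ℝ≥0∞ :=
  (∫⁻ x, ENNReal.ofReal ((N.toFun n x - (normLp 2 f).toReal) ^ 2) ∂(sampleLaw f n))
    ^ (1 / 2 : ℝ)

/-- Maximal risk over a set of densities. -/
def maxRisk {d : ℕ} (N : Estimator d) (n : ℕ) (F : Set ((Fin d → ℝ) → ℝ)) : ℝ≥0∞ :=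
  ⨆ f ∈ F, risk N n f

/-! ## Admissible normalization families and adaptive rates of convergence -/

/-- The family `μ n θ`, `θ ∈ Θ`, is an admissible normalization family over the classes
`boundedClass d θ L Q`, `θ ∈ Θ`, `L > 0`, `Q > 0`: it is positive for all large `n`, and one
estimator attains it on each of the classes. -/
def IsAdmissible (d : ℕ) (Θ : Set RateParam) (μ : ℕ → RateParam → ℝ) : Prop :=
  (∀ θ ∈ Θ, ∀ᶠ n in atTop, 0 < μ n θ) ∧
    ∃ N : Estimator d, ∀ θ ∈ Θ, ∀ L Q : ℝ, 0 < L → 0 < Q →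
      limsup (fun n => maxRisk N n (boundedClass d θ L Q) / ENNReal.ofReal (μ n θ)) atTop < ∞

/-- The parameters at which `μ` outperforms `ψ` in order: `ψ n θ / μ n θ → ∞`. -/
def outperformSet (Θ : Set RateParam) (ψ μ : ℕ → RateParam → ℝ) : Set RateParam :=
  {θ | θ ∈ Θ ∧ Tendsto (fun n => ψ n θ / μ n θ) atTop atTop}

/-- `S` contains a Euclidean ball of `ℝ^2`. -/
def ContainsBall (S : Set RateParam) : Prop :=
  ∃ β₀ r₀ ε : ℝ, 0 < ε ∧ ∀ β r : ℝ, (β - β₀) ^ 2 + (r - r₀) ^ 2 < ε ^ 2 →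
    0 ≤ r ∧ (β, ENNReal.ofReal r) ∈ S

/-- `T`, with the subspace topology, is a topological manifold (with or without boundary, not
necessarily connected) of dimension one. Hausdorffness and second countability are inherited
from the ambient space. -/
def IsCurve (T : Set RateParam) : Prop :=
  Nonempty (ChartedSpace (EuclideanHalfSpace 1) T)

/-- The normalization family `ψ` is the adaptive rate of convergence over the scale
`boundedClass d θ L Q`, `θ ∈ Θ`, `L > 0`, `Q > 0`. -/
structure IsAdaptiveRate (d : ℕ) (Θ : Set RateParam) (ψ : ℕ → RateParam → ℝ) : Prop where
  admissible : IsAdmissible d Θ ψ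
  negligible : ∀ μ, IsAdmissible d Θ μ →
    ∃ T : Set RateParam, T ⊆ Θ ∧ IsCurve T ∧ outperformSet Θ ψ μ ⊆ T
  compensated : ∀ μ, IsAdmissible d Θ μ → ∀ θ ∈ outperformSet Θ ψ μ,
    ∃ S : Set RateParam, S ⊆ Θ ∧ ContainsBall S ∧
      ∀ θ' ∈ S, Tendsto (fun n => ψ n θ' / μ n θ' * (ψ n θ / μ n θ)) atTop (𝓝 0)

/-! ## The rate exponent and the parameter sets of the nonparametric regime -/

/-- `1 / r` as a real number, with `1 / ∞ = 0`. -/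
def invIndex (r : ℝ≥0∞) : ℝ := (r⁻¹).toReal

/-- The exponent `z*(β, r)`. Numerators, denominators and inequalities are divided by `r`, so that
`r = ∞` is covered: `βr / (βr + d(r-1)) = β / (β + d(1 - 1/r))`, and so on. -/
def rateExponent (d : ℕ) (θ : RateParam) : ℝ :=
  if 2 ≤ θ.2 then
    if θ.1 < d * (1 - invIndex θ.2) then θ.1 / (θ.1 + d * (1 - invIndex θ.2)) else 1 / 2
  else
    if θ.1 < d * invIndex θ.2 then θ.1 / (θ.1 + d * invIndex θ.2) else 1 / 2

/-- The set `(0, b] × [1, ∞]`. -/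
def rateParams (b : ℝ≥0∞) : Set RateParam :=
  {θ | 0 < θ.1 ∧ ENNReal.ofReal θ.1 ≤ b ∧ 1 ≤ θ.2}

/-- `r ≥ 2` and `βr < d(r-1)`. -/
def zone₁ (d : ℕ) (b : ℝ≥0∞) : Set RateParam :=
  {θ | θ ∈ rateParams b ∧ 2 ≤ θ.2 ∧ θ.1 < d * (1 - invIndex θ.2)}

/-- `r < 2` and `βr < d`. -/
def zone₂ (d : ℕ) (b : ℝ≥0∞) : Set RateParam :=
  {θ | θ ∈ rateParams b ∧ θ.2 < 2 ∧ θ.1 < d * invIndex θ.2}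

/-- The parameters of the nonparametric regime. The corner `(b, 2)` is left out: it lies in
`zone₁ d b` only if `b < d / 2`, and then it is the only parameter of the two zones at which the
exponent attains its maximum, so that no class of the scale has a better rate. -/
def nonparametric (d : ℕ) (b : ℝ≥0∞) : Set RateParam :=
  {θ | θ ∈ zone₁ d b ∪ zone₂ d b ∧ ¬ (ENNReal.ofReal θ.1 = b ∧ θ.2 = 2)}

/-- The normalization `(√(ln n) / n) ^ z*(θ)`. -/
def psiStar (d : ℕ) (n : ℕ) (θ : RateParam) : ℝ :=
  (Real.sqrt (Real.log n) / n) ^ rateExponent d θ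

end L2NormEstimation

end

/-!
An estimator that beats the normalization `psiStar d n θ` at one parameter must pay at every
parameter with a larger exponent, and the price exceeds the gain by a power of `n`.

The price comes from testing one density `f₀` of the class with parameters `θ'` against a mixture
of densities of the class with parameters `θ` (`risk_lower_bound_of_mixture`). The density `f₀` is
constant on a cube, and the mixture multiplies it by `1 + ρ F`, where `F` is a sum, with independent
random signs, of smooth bumps of mean zero on small cells of the cube
(`maxRisk_lower_bound_of_flat`). All members of the mixture have the same `L₂`-norm, which exceeds
that of `f₀` by a constant multiple of `ρ ^ 2 * psiStar d n θ`, while the second moment of the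
likelihood ratio is only `n ^ (C * ρ ^ 4)`. For small `ρ` an estimator with risk `o(psiStar d n θ)`
on the class of `θ` thus has risk at least `n ^ (-ε) * psiStar d n θ` at `f₀` (`maxRisk_dichotomy`).
In the first zone `f₀` is spread out over a large cube, with small amplitude, and it is smooth enough
for all classes. In the second zone `f₀` has a peak of height of order one and of small width, and it
belongs to all classes with `β r ≤ d`, in particular to those of the second zone. The same bound with
`θ' = θ` shows that the gain at `θ` is at most a small power of `n`, and
`tendsto_mul_of_mem_outperformSet` follows.

Consequently all outperformed parameters of one zone have the same exponent
(`rateExponent_le_of_mem_outperformSet`), so that the outperformed set is contained in the union of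
two level sets of the exponent. With `s = 1 / r`, a level set is a piece of the graph of
`β = q d max(s, 1 - s)`, an arc that is not reduced to a point since the corner `(b, 2)` is left out
(`exists_arc_eq_levelSet`); two level sets are equal or disjoint. The parameters that compensate for
the outperformance at `θ` are those of the second zone with a larger exponent. They contain a ball
since, again because the corner is left out, the exponent at `θ` is smaller than its supremum, which
is approached in the second zone as `r` tends to `2`.
-/

namespace L2NormEstimation

/-! ### Iterated differences -/

lemma diffOp_add {d : ℕ} (u : ℝ) (j : Fin d) (f g : (Fin d → ℝ) → ℝ) :
    diffOp u j (f + g) = diffOp u j f + diffOp u j g := by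
  ext x
  simp only [diffOp, Pi.add_apply]
  ring

lemma iterate_diffOp_add {d : ℕ} (u : ℝ) (j : Fin d) (k : ℕ) (f g : (Fin d → ℝ) → ℝ) :
    (diffOp u j)^[k] (f + g) = (diffOp u j)^[k] f + (diffOp u j)^[k] g := by
  induction k generalizing f g with
  | zero => rfl
  | succ k ih => rw [Function.iterate_succ_apply, diffOp_add, ih]; rfl

lemma diffOp_smul {d : ℕ} (u : ℝ) (j : Fin d) (c : ℝ) (f : (Fin d → ℝ) → ℝ) :
    diffOp u j (c • f) = c • diffOp u j f := by
  ext x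
  simp only [diffOp, Pi.smul_apply, smul_eq_mul]
  ring

lemma iterate_diffOp_smul {d : ℕ} (u : ℝ) (j : Fin d) (k : ℕ) (c : ℝ) (f : (Fin d → ℝ) → ℝ) :
    (diffOp u j)^[k] (c • f) = c • (diffOp u j)^[k] f := by
  induction k generalizing f with
  | zero => rfl
  | succ k ih => rw [Function.iterate_succ_apply, diffOp_smul, ih]; rfl

lemma measurable_iterate_diffOp {d : ℕ} (u : ℝ) (j : Fin d) (k : ℕ) {f : (Fin d → ℝ) → ℝ}
    (hf : Measurable f) : Measurable ((diffOp u j)^[k] f) := by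
  induction k generalizing f with
  | zero => exact hf
  | succ k ih =>
    rw [Function.iterate_succ_apply]
    exact ih ((hf.comp (measurable_id.add_const _)).sub hf)

lemma abs_iterate_diffOp_le_two_pow {d : ℕ} (u : ℝ) (j : Fin d) (k : ℕ) {f : (Fin d → ℝ) → ℝ}
    {A : ℝ} (hf : ∀ x, |f x| ≤ A) (x : Fin d → ℝ) : |(diffOp u j)^[k] f x| ≤ 2 ^ k * A := by
  induction k generalizing f A with
  | zero => simpa using hf x
  | succ k ih =>
    rw [Function.iterate_succ_apply, pow_succ, mul_assoc]
    refine ih fun y => ?_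
    have h := abs_sub (f (y + u • Pi.single j (1 : ℝ))) (f y)
    have h1 := hf (y + u • Pi.single j (1 : ℝ))
    have h2 := hf y
    simp only [diffOp]
    linarith

/-- If `g 0, g 1, …, g k` are successive derivatives in the `j`-th direction, the `k`-th
difference of `g 0` with step `u` is at most `|u| ^ k * sup |g k|`. -/
lemma abs_iterate_diffOp_le_of_hasDerivAt {d : ℕ} (u : ℝ) (j : Fin d) (k : ℕ)
    (g : ℕ → (Fin d → ℝ) → ℝ)
    (hg : ∀ i x, HasDerivAt (fun t : ℝ => g i (x + t • Pi.single j (1 : ℝ))) (g (i + 1) x) 0)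
    {C : ℝ} (hC : ∀ x, |g k x| ≤ C) (x : Fin d → ℝ) :
    |(diffOp u j)^[k] (g 0) x| ≤ |u| ^ k * C := by
  have shift : ∀ (i : ℕ) (x : Fin d → ℝ) (s : ℝ),
      HasDerivAt (fun t : ℝ => g i (x + t • Pi.single j (1 : ℝ)))
        (g (i + 1) (x + s • Pi.single j (1 : ℝ))) s := by
    intro i x s
    have h := hg i (x + s • Pi.single j (1 : ℝ))
    rw [show (0 : ℝ) = s - s by ring] at h
    have h' := HasDerivAt.comp_sub_const s s h
    refine h'.congr_of_eventuallyEq (Eventually.of_forall fun t => ?_)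
    simp only
    congr 1
    rw [add_assoc, ← add_smul]
    congr 2
    ring
  induction k generalizing g C with
  | zero => simpa using hC x
  | succ k ih =>
    rw [Function.iterate_succ_apply, pow_succ, mul_assoc]
    refine ih (fun i => diffOp u j (g i)) ?_ ?_ ?_
    · intro i y
      have h1 := hg i (y + u • Pi.single j (1 : ℝ))
      have h2 := hg i y
      have h3 := h1.sub h2
      refine h3.congr_of_eventuallyEq (Eventually.of_forall fun t => ?_)
      simp only [diffOp, Pi.sub_apply]
      rw [add_right_comm]
    · intro y
      have h := Convex.norm_image_sub_le_of_norm_hasDerivWithin_le (s := Set.univ) (x := 0) (y := u)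
        (C := C) (fun s _ => (shift k y s).hasDerivWithinAt) (fun s _ => hC _) convex_univ
        (Set.mem_univ _) (Set.mem_univ _)
      simp only [diffOp]
      simpa [mul_comm] using h
    · intro i y s
      have h1 := shift i (y + u • Pi.single j (1 : ℝ)) s
      have h2 := shift i y s
      have h3 := h1.sub h2
      refine (h3.congr_of_eventuallyEq (Eventually.of_forall fun t => ?_)).congr_deriv ?_
      · simp only [diffOp, Pi.sub_apply]
        rw [add_right_comm]
      · simp only [diffOp]
        rw [add_right_comm]

/-- A `k`-th difference of `g` vanishes off `k + 1` translates of the support of `g`. -/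
lemma exists_mem_of_iterate_diffOp_ne_zero {d : ℕ} (u : ℝ) (j : Fin d) (k : ℕ)
    {g : (Fin d → ℝ) → ℝ} {B : Set (Fin d → ℝ)} (hB : ∀ x, g x ≠ 0 → x ∈ B) {x : Fin d → ℝ}
    (hx : (diffOp u j)^[k] g x ≠ 0) :
    ∃ i ∈ Finset.range (k + 1), x + ((i : ℝ) * u) • Pi.single j (1 : ℝ) ∈ B := by
  induction k generalizing x with
  | zero => exact ⟨0, by simp, by simpa using hB x hx⟩
  | succ k ih =>
    rw [Function.iterate_succ_apply', diffOp] at hx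
    by_cases h : (diffOp u j)^[k] g x = 0
    · rw [h, sub_zero] at hx
      obtain ⟨i, hi, hiB⟩ := ih hx
      refine ⟨i + 1, by simp at hi ⊢; omega, ?_⟩
      rw [add_assoc, ← add_smul] at hiB
      push_cast
      rwa [show ((i : ℝ) + 1) * u = u + i * u by ring]
    · obtain ⟨i, hi, hiB⟩ := ih h
      exact ⟨i, by simp at hi ⊢; omega, hiB⟩

/-! ### Norms of bounded functions with small support -/

lemma invIndex_nonneg (r : ℝ≥0∞) : 0 ≤ invIndex r := ENNReal.toReal_nonneg

lemma invIndex_le_one {r : ℝ≥0∞} (hr : 1 ≤ r) : invIndex r ≤ 1 := by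
  have h : r⁻¹ ≤ 1 := ENNReal.inv_le_one.mpr hr
  simpa [invIndex] using ENNReal.toReal_mono ENNReal.one_ne_top h

lemma normLp_le {d : ℕ} {r : ℝ≥0∞} (hr : 1 ≤ r) {g : (Fin d → ℝ) → ℝ} {A v : ℝ}
    {B : Set (Fin d → ℝ)} (hBm : MeasurableSet B) (hA : ∀ x, |g x| ≤ A)
    (hB : ∀ x, g x ≠ 0 → x ∈ B) (hv : volume B ≤ ENNReal.ofReal v) (hv0 : 0 ≤ v) :
    normLp r g ≤ ENNReal.ofReal (A * v ^ invIndex r) := by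
  have hA0 : 0 ≤ A := (abs_nonneg _).trans (hA 0)
  unfold normLp
  split_ifs with h
  · subst h
    simp only [invIndex, ENNReal.inv_top, ENNReal.toReal_zero, Real.rpow_zero, mul_one]
    exact iSup_le fun x => ENNReal.ofReal_le_ofReal (hA x)
  · have hg : g = B.indicator g := by
      ext x
      by_cases hx : x ∈ B
      · simp [hx]
      · have : g x = 0 := by_contra fun h => hx (hB x h)
        simp [hx, this]
    have hBf : volume B ≠ ∞ := ne_top_of_le_ne_top ENNReal.ofReal_ne_top hv
    have : IsFiniteMeasure (volume.restrict B) := ⟨by simpa using hBf.lt_top⟩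
    rw [hg, eLpNorm_indicator_eq_eLpNorm_restrict hBm]
    refine (eLpNorm_le_of_ae_bound (C := A) (Eventually.of_forall fun x => hA x)).trans ?_
    rw [mul_comm, ENNReal.ofReal_mul hA0]
    gcongr
    rw [Measure.restrict_apply_univ, invIndex, ENNReal.toReal_inv]
    have hi : (0 : ℝ) ≤ r.toReal⁻¹ := by positivity
    rw [← ENNReal.ofReal_rpow_of_nonneg hv0 hi]
    exact ENNReal.rpow_le_rpow hv hi

lemma normLp_add_le {d : ℕ} {r : ℝ≥0∞} (hr : 1 ≤ r) {f g : (Fin d → ℝ) → ℝ}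
    (hf : Measurable f) (hg : Measurable g) : normLp r (f + g) ≤ normLp r f + normLp r g := by
  unfold normLp
  split_ifs with h
  · refine iSup_le fun x => ?_
    calc ENNReal.ofReal |(f + g) x| ≤ ENNReal.ofReal (|f x| + |g x|) :=
          ENNReal.ofReal_le_ofReal (abs_add_le _ _)
      _ = ENNReal.ofReal |f x| + ENNReal.ofReal |g x| :=
          ENNReal.ofReal_add (abs_nonneg _) (abs_nonneg _)
      _ ≤ _ := add_le_add (le_iSup (fun x => ENNReal.ofReal |f x|) x)
          (le_iSup (fun x => ENNReal.ofReal |g x|) x)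
  · exact eLpNorm_add_le hf.aestronglyMeasurable hg.aestronglyMeasurable hr

/-! ### Smoothness of bounded functions with small support -/

/-- `g` satisfies the conditions of the isotropic Nikolskii class with parameters `β`, `r` and
`L`, with differences of the given order `k` in every direction. -/
structure SmoothOfOrder {d : ℕ} (k : ℕ) (β : ℝ) (r : ℝ≥0∞) (L : ℝ) (g : (Fin d → ℝ) → ℝ) :
    Prop where
  measurable : Measurable g
  norm_le : normLp r g ≤ ENNReal.ofReal L
  diff_le : ∀ u j, normLp r ((diffOp u j)^[k] g) ≤ ENNReal.ofReal (L * |u| ^ β)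

lemma SmoothOfOrder.mem_nikolskii {d k : ℕ} {β L : ℝ} {r : ℝ≥0∞} {g : (Fin d → ℝ) → ℝ}
    (h : SmoothOfOrder k β r L g) (hk : β < k) :
    g ∈ nikolskii (fun _ => r) (fun _ => β) (fun _ => L) :=
  ⟨fun _ => h.norm_le, fun _ => k, fun _ => hk, fun u j => h.diff_le u j⟩

lemma SmoothOfOrder.mono {d k : ℕ} {β L L' : ℝ} {r : ℝ≥0∞} {g : (Fin d → ℝ) → ℝ}
    (h : SmoothOfOrder k β r L g) (hL : L ≤ L') : SmoothOfOrder k β r L' g where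
  measurable := h.measurable
  norm_le := h.norm_le.trans (ENNReal.ofReal_le_ofReal hL)
  diff_le u j := (h.diff_le u j).trans (ENNReal.ofReal_le_ofReal (by gcongr))

lemma SmoothOfOrder.add {d k : ℕ} {β L L' : ℝ} {r : ℝ≥0∞} {f g : (Fin d → ℝ) → ℝ}
    (hr : 1 ≤ r) (hL : 0 ≤ L) (hL' : 0 ≤ L')
    (hf : SmoothOfOrder k β r L f) (hg : SmoothOfOrder k β r L' g) :
    SmoothOfOrder k β r (L + L') (f + g) where
  measurable := hf.measurable.add hg.measurable
  norm_le := by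
    rw [ENNReal.ofReal_add hL hL']
    exact (normLp_add_le hr hf.measurable hg.measurable).trans (add_le_add hf.norm_le hg.norm_le)
  diff_le u j := by
    rw [iterate_diffOp_add, add_mul, ENNReal.ofReal_add (by positivity) (by positivity)]
    exact (normLp_add_le hr (measurable_iterate_diffOp u j k hf.measurable)
      (measurable_iterate_diffOp u j k hg.measurable)).trans
      (add_le_add (hf.diff_le u j) (hg.diff_le u j))

/-- A function of amplitude `A`, living on a set of volume `v` and oscillating at scale `h`,
belongs to the Nikolskii class of radius of order `A * v ^ (1 / r) * h ^ (-β)`. -/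
lemma smoothOfOrder_of_bounded {d k : ℕ} {β : ℝ} {r : ℝ≥0∞} (hr : 1 ≤ r) (hβ : 0 < β)
    (hk : β < k) {g : (Fin d → ℝ) → ℝ} (hg : Measurable g) {A C v h : ℝ} (hC : 1 ≤ C)
    (hh : 0 < h) (hv0 : 0 ≤ v) {B : Set (Fin d → ℝ)} (hBm : MeasurableSet B)
    (hA : ∀ x, |g x| ≤ A) (hB : ∀ x, g x ≠ 0 → x ∈ B) (hv : volume B ≤ ENNReal.ofReal v)
    (hd : ∀ u j x, |(diffOp u j)^[k] g x| ≤ A * C * (|u| / h) ^ k) {L : ℝ}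
    (hL1 : A * v ^ invIndex r ≤ L)
    (hL2 : A * (C + 2 ^ k) * (((k : ℝ) + 1) * v) ^ invIndex r ≤ L * h ^ β) :
    SmoothOfOrder k β r L g where
  measurable := hg
  norm_le := (normLp_le hr hBm hA hB hv hv0).trans (ENNReal.ofReal_le_ofReal hL1)
  diff_le u j := by
    have hA0 : 0 ≤ A := (abs_nonneg _).trans (hA 0)
    have hk0 : (0 : ℝ) < k := hβ.trans hk
    set B' : Set (Fin d → ℝ) := ⋃ i ∈ Finset.range (k + 1),
      (fun x => x + ((i : ℝ) * u) • (Pi.single j (1 : ℝ) : Fin d → ℝ)) ⁻¹' B with hB'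
    have hB'm : MeasurableSet B' :=
      Finset.measurableSet_biUnion _ fun i _ => (measurable_id.add_const _) hBm
    have hB'v : volume B' ≤ ENNReal.ofReal (((k : ℝ) + 1) * v) := by
      refine (measure_biUnion_finset_le _ _).trans ?_
      simp only [measure_preimage_add_right, Finset.sum_const, Finset.card_range, nsmul_eq_mul]
      rw [ENNReal.ofReal_mul (by positivity)]
      refine mul_le_mul' (le_of_eq ?_) hv
      rw [← Nat.cast_succ, ENNReal.ofReal_natCast]
    set D : ℝ := A * (C + 2 ^ k) * (|u| / h) ^ β with hD
    have hbound : ∀ x, |(diffOp u j)^[k] g x| ≤ D := by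
      intro x
      have hs : 0 ≤ |u| / h := by positivity
      rcases le_total (|u| / h) 1 with h1 | h1
      · have h2 : (|u| / h) ^ k ≤ (|u| / h) ^ β := by
          rcases hs.eq_or_lt with h0 | h0
          · rw [← h0, Real.zero_rpow hβ.ne', zero_pow (by rintro rfl; simp at hk0)]
          · rw [← Real.rpow_natCast]
            exact Real.rpow_le_rpow_of_exponent_ge h0 h1 hk.le
        refine (hd u j x).trans ?_
        rw [hD]
        gcongr
        linarith [pow_pos (two_pos (α := ℝ)) k]
      · have h2 : 1 ≤ (|u| / h) ^ β := Real.one_le_rpow h1 hβ.le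
        calc |(diffOp u j)^[k] g x| ≤ 2 ^ k * A := abs_iterate_diffOp_le_two_pow u j k hA x
          _ = A * 2 ^ k * 1 := by ring
          _ ≤ A * (C + 2 ^ k) * (|u| / h) ^ β := by gcongr; linarith
    refine (normLp_le hr hB'm hbound ?_ hB'v (by positivity)).trans
      (ENNReal.ofReal_le_ofReal ?_)
    · intro x hx
      obtain ⟨i, hi, hx'⟩ := exists_mem_of_iterate_diffOp_ne_zero u j k hB hx
      exact Set.mem_biUnion (Finset.mem_coe.mpr hi) hx'
    · have hhβ : 0 < h ^ β := Real.rpow_pos_of_pos hh β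
      rw [hD, Real.div_rpow (abs_nonneg u) hh.le]
      calc A * (C + 2 ^ k) * (|u| ^ β / h ^ β) * (((k : ℝ) + 1) * v) ^ invIndex r
          = (A * (C + 2 ^ k) * (((k : ℝ) + 1) * v) ^ invIndex r) * |u| ^ β / h ^ β := by ring
        _ ≤ (L * h ^ β) * |u| ^ β / h ^ β := by gcongr
        _ = L * |u| ^ β := by field_simp

/-! ### Smooth profiles on the line -/

/-- A smooth probability density on the line that is constant on `[0, 1]`. -/
lemma exists_flat_density :
    ∃ φ : ℝ → ℝ, ContDiff ℝ ((⊤ : ℕ∞) : WithTop ℕ∞) φ ∧ HasCompactSupport φ ∧ (∀ t, 0 ≤ φ t) ∧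
      ∫ t, φ t = 1 ∧ (∀ t, φ t ≠ 0 → t ∈ Set.Icc (-1 : ℝ) 2) ∧
      ∃ c₀ : ℝ, 0 < c₀ ∧ ∀ t ∈ Set.Icc (0 : ℝ) 1, φ t = c₀ := by
  let f : ContDiffBump (1 / 2 : ℝ) := ⟨1 / 2, 1, by norm_num, by norm_num⟩
  refine ⟨f.normed volume, f.contDiff_normed, f.hasCompactSupport_normed,
    fun t => f.nonneg_normed t, f.integral_normed, fun t ht => ?_, 1 / ∫ x, f x,
    one_div_pos.mpr f.integral_pos, fun t ht => ?_⟩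
  · have h1 : t ∈ Function.support (f.normed volume) := ht
    rw [f.support_normed_eq, Real.ball_eq_Ioo] at h1
    have h2 : f.rOut = 1 := rfl
    rw [h2] at h1
    exact ⟨by linarith [h1.1], by linarith [h1.2]⟩
  · rw [f.normed_def, f.one_of_mem_closedBall]
    rw [Real.closedBall_eq_Icc]
    have h2 : f.rIn = 1 / 2 := rfl
    rw [h2]
    exact ⟨by linarith [ht.1], by linarith [ht.2]⟩

/-- A smooth function on the line of mean zero that lives in the open interval `(0, 1)`. -/
lemma exists_oscillating_profile :
    ∃ φ : ℝ → ℝ, ContDiff ℝ ((⊤ : ℕ∞) : WithTop ℕ∞) φ ∧ HasCompactSupport φ ∧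
      ∫ t, φ t = 0 ∧ (∀ t, |φ t| ≤ 1) ∧ (∀ k t, iteratedDeriv k φ t ≠ 0 → t ∈ Set.Ioo (0 : ℝ) 1) ∧
      0 < ∫ t, φ t ^ 2 := by
  let f : ContDiffBump (0 : ℝ) := ⟨1 / 16, 1 / 8, by norm_num, by norm_num⟩
  have hR : f.rOut = 1 / 8 := rfl
  let φ : ℝ → ℝ := fun t => f (t - 1 / 4) - f (t - 3 / 4)
  have hsm : ContDiff ℝ ((⊤ : ℕ∞) : WithTop ℕ∞) φ :=
    (f.contDiff.comp (contDiff_id.sub contDiff_const)).sub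
      (f.contDiff.comp (contDiff_id.sub contDiff_const))
  have hfz : ∀ t, 1 / 8 ≤ |t| → f t = 0 := by
    intro t ht
    refine f.zero_of_le_dist ?_
    rwa [Real.dist_eq, sub_zero, hR]
  have hsupp : Function.support φ ⊆ Set.Icc (1 / 8 : ℝ) (7 / 8) := by
    intro t ht
    by_contra hn
    refine ht ?_
    simp only [φ]
    rw [Set.mem_Icc, not_and_or, not_le, not_le] at hn
    rcases hn with hn | hn
    · rw [hfz, hfz, sub_zero]
      · rw [abs_of_neg (by linarith)]; linarith
      · rw [abs_of_neg (by linarith)]; linarith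
    · rw [hfz, hfz, sub_zero]
      · rw [abs_of_pos (by linarith)]; linarith
      · rw [abs_of_pos (by linarith)]; linarith
  have htsupp : tsupport φ ⊆ Set.Icc (1 / 8 : ℝ) (7 / 8) := closure_minimal hsupp isClosed_Icc
  have hcs : HasCompactSupport φ := isCompact_Icc.of_isClosed_subset (isClosed_tsupport φ) htsupp
  have hint : Integrable f := f.continuous.integrable_of_hasCompactSupport f.hasCompactSupport
  have hder : ∀ k, tsupport (iteratedDeriv k φ) ⊆ Set.Icc (1 / 8 : ℝ) (7 / 8) := by
    intro k
    induction k with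
    | zero => simpa using htsupp
    | succ k ih =>
      rw [iteratedDeriv_succ]
      exact (closure_minimal support_deriv_subset (isClosed_tsupport _)).trans ih
  refine ⟨φ, hsm, hcs, ?_, ?_, ?_, ?_⟩
  · simp only [φ]
    rw [integral_sub (hint.comp_sub_right _) (hint.comp_sub_right _),
      integral_sub_right_eq_self (fun t => f t), integral_sub_right_eq_self (fun t => f t), sub_self]
  · intro t
    have h1 := f.nonneg (x := t - 1 / 4)
    have h2 := f.le_one (x := t - 1 / 4)
    have h3 := f.nonneg (x := t - 3 / 4)
    have h4 := f.le_one (x := t - 3 / 4)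
    rw [abs_le]
    constructor <;> simp only [φ] <;> linarith
  · intro k t ht
    have := hder k (subset_tsupport _ ht)
    exact ⟨by linarith [this.1], by linarith [this.2]⟩
  · refine Continuous.integral_pos_of_hasCompactSupport_nonneg_nonzero (x := 1 / 4)
      (hsm.continuous.pow 2) ?_ (fun t => sq_nonneg _) ?_
    · exact hcs.comp_left (g := fun y : ℝ => y ^ 2) (by simp)
    · have h1 : f (1 / 4 - 1 / 4) = 1 := f.one_of_mem_closedBall (by
        simp only [sub_self, Metric.mem_closedBall, dist_self]; exact f.rIn_pos.le)
      have h2 : f (1 / 4 - 3 / 4) = 0 := hfz _ (by norm_num [abs_of_neg])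
      simp only [φ, h1, h2]
      norm_num

lemma exists_bound_iteratedDeriv {φ : ℝ → ℝ} (hφ : ContDiff ℝ ((⊤ : ℕ∞) : WithTop ℕ∞) φ)
    (hc : HasCompactSupport φ) (k : ℕ) : ∃ B, ∀ t, |iteratedDeriv k φ t| ≤ B := by
  have hcs : HasCompactSupport (iteratedDeriv k φ) := by
    induction k with
    | zero => simpa using hc
    | succ k ih => rw [iteratedDeriv_succ]; exact ih.deriv
  exact (hφ.continuous_iteratedDeriv k (by exact_mod_cast le_top)).bounded_above_of_compact_support
    hcs

/-! ### Weighted sums of product bumps over a grid of cells -/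

/-- The sum over the cells `∏ l, [m l * h, (m l + 1) * h]`, `m l < p`, of copies of the product
function `∏ l, φ l` at scale `h`, with weights `w m`. -/
noncomputable def cellSum {d p : ℕ} (φ : Fin d → ℝ → ℝ) (h : ℝ) (w : (Fin d → Fin p) → ℝ) (x : Fin d → ℝ) : ℝ :=
  ∑ m, w m * ∏ l, φ l (x l / h - (m l : ℕ))

variable {d p : ℕ}

lemma continuous_cellSum {φ : Fin d → ℝ → ℝ} (hφ : ∀ l, Continuous (φ l)) (h : ℝ)
    (w : (Fin d → Fin p) → ℝ) : Continuous (cellSum φ h w) := by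
  unfold cellSum
  refine continuous_finsetSum _ fun m _ => continuous_const.mul ?_
  refine continuous_finsetProd _ fun l _ => (hφ l).comp ?_
  exact (Continuous.div_const (continuous_apply l : Continuous fun x : Fin d → ℝ => x l) h).sub
    continuous_const

lemma abs_cellSum_le {φ : Fin d → ℝ → ℝ} {B : ℝ}
    (hφ : ∀ l t, ∑ m : Fin p, |φ l (t - (m : ℕ))| ≤ B) {w : (Fin d → Fin p) → ℝ}
    (hw : ∀ m, |w m| ≤ 1) (h : ℝ) (x : Fin d → ℝ) : |cellSum φ h w x| ≤ B ^ d := by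
  calc |cellSum φ h w x| ≤ ∑ m : Fin d → Fin p, |w m * ∏ l, φ l (x l / h - (m l : ℕ))| :=
        Finset.abs_sum_le_sum_abs _ _
    _ ≤ ∑ m : Fin d → Fin p, ∏ l, |φ l (x l / h - (m l : ℕ))| := by
        refine Finset.sum_le_sum fun m _ => ?_
        rw [abs_mul, Finset.abs_prod]
        exact mul_le_of_le_one_left (Finset.prod_nonneg fun _ _ => abs_nonneg _) (hw m)
    _ = ∏ l, ∑ m : Fin p, |φ l (x l / h - (m : ℕ))| := by
        rw [Finset.prod_univ_sum, Fintype.piFinset_univ]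
    _ ≤ ∏ _l : Fin d, B :=
        Finset.prod_le_prod (fun l _ => Finset.sum_nonneg fun _ _ => abs_nonneg _)
          fun l _ => hφ l _
    _ = B ^ d := by simp

lemma hasDerivAt_cellSum {φ : Fin d → ℝ → ℝ} {ψ : ℝ → ℝ} {j : Fin d}
    (hφ : ∀ t, HasDerivAt (φ j) (ψ t) t) (h : ℝ) (w : (Fin d → Fin p) → ℝ) (x : Fin d → ℝ) :
    HasDerivAt (fun t : ℝ => cellSum φ h w (x + t • Pi.single j (1 : ℝ)))
      (h⁻¹ * cellSum (Function.update φ j ψ) h w x) 0 := by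
  unfold cellSum
  rw [Finset.mul_sum]
  refine HasDerivAt.fun_sum fun m _ => ?_
  have key : ∀ y : Fin d → ℝ, ∀ χ : ℝ → ℝ,
      ∏ l, Function.update φ j χ l (y l / h - (m l : ℕ)) =
        χ (y j / h - (m j : ℕ)) * ∏ l ∈ Finset.univ.erase j, φ l (y l / h - (m l : ℕ)) := by
    intro y χ
    rw [← Finset.mul_prod_erase _ _ (Finset.mem_univ j)]
    congr 1
    · simp
    · refine Finset.prod_congr rfl fun l hl => ?_
      rw [Function.update_of_ne (Finset.ne_of_mem_erase hl)]
  have h0 : ∀ t : ℝ, w m * ∏ l, φ l ((x + t • (Pi.single j (1 : ℝ) : Fin d → ℝ)) l / h - (m l : ℕ)) =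
      w m * (φ j ((x j + t) / h - (m j : ℕ)) *
        ∏ l ∈ Finset.univ.erase j, φ l (x l / h - (m l : ℕ))) := by
    intro t
    have := key (x + t • (Pi.single j (1 : ℝ) : Fin d → ℝ)) (φ j)
    rw [Function.update_eq_self] at this
    rw [this]
    congr 2
    · simp
    · refine Finset.prod_congr rfl fun l hl => ?_
      simp [Pi.single_eq_of_ne (Finset.ne_of_mem_erase hl)]
  simp_rw [h0]
  rw [key x ψ]
  have h1 : HasDerivAt (fun t : ℝ => (x j + t) / h - (m j : ℕ)) h⁻¹ 0 := by
    have := (((hasDerivAt_id (0 : ℝ)).const_add (x j)).div_const h).sub_const ((m j : ℕ) : ℝ)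
    simpa using this
  have h2 := (HasDerivAt.comp (0 : ℝ) (hφ ((x j + 0) / h - (m j : ℕ))) h1)
  have h3 := (h2.mul_const (∏ l ∈ Finset.univ.erase j, φ l (x l / h - (m l : ℕ)))).const_mul (w m)
  refine h3.congr_deriv ?_
  rw [add_zero]
  ring

/-- Differences of a sum of cells at scale `h` gain a factor `|u| / h` for each order. -/
lemma abs_iterate_diffOp_cellSum_le {φ : ℝ → ℝ} (hφ : ContDiff ℝ ((⊤ : ℕ∞) : WithTop ℕ∞) φ)
    {k : ℕ} {B : ℝ} (hB : ∀ t, ∑ m : Fin p, |φ (t - (m : ℕ))| ≤ B)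
    (hBk : ∀ t, ∑ m : Fin p, |iteratedDeriv k φ (t - (m : ℕ))| ≤ B) {w : (Fin d → Fin p) → ℝ}
    (hw : ∀ m, |w m| ≤ 1) {h : ℝ} (hh : 0 < h) (u : ℝ) (j : Fin d) (x : Fin d → ℝ) :
    |(diffOp u j)^[k] (cellSum (fun _ => φ) h w) x| ≤ B ^ d * (|u| / h) ^ k := by
  set g : ℕ → (Fin d → ℝ) → ℝ := fun i x =>
    (h⁻¹) ^ i * cellSum (Function.update (fun _ => φ) j (iteratedDeriv i φ)) h w x with hg
  have hg0 : g 0 = cellSum (fun _ => φ) h w := by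
    ext x
    simp [hg]
  have hgk : ∀ x, |g k x| ≤ (h⁻¹) ^ k * B ^ d := by
    intro x
    rw [hg, abs_mul, abs_of_nonneg (by positivity)]
    gcongr
    refine abs_cellSum_le (fun l t => ?_) hw h x
    rcases eq_or_ne l j with rfl | hl
    · simpa using hBk t
    · simpa [Function.update_of_ne hl] using hB t
  have hchain := abs_iterate_diffOp_le_of_hasDerivAt u j k g ?_ hgk x
  · rw [hg0] at hchain
    refine hchain.trans (le_of_eq ?_)
    rw [div_pow, inv_pow]
    ring
  · intro i x
    have hd : ∀ t, HasDerivAt (iteratedDeriv i φ) (iteratedDeriv (i + 1) φ t) t := by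
      intro t
      rw [iteratedDeriv_succ]
      exact ((hφ.differentiable_iteratedDeriv i
        (by exact_mod_cast WithTop.coe_lt_top i)) t).hasDerivAt
    have h1 := hasDerivAt_cellSum (φ := Function.update (fun _ => φ) j (iteratedDeriv i φ))
      (ψ := iteratedDeriv (i + 1) φ) (j := j) (by simpa using hd) h w x
    rw [Function.update_idem] at h1
    refine (h1.const_mul ((h⁻¹) ^ i)).congr_deriv ?_
    simp only [hg, pow_succ]
    ring

lemma mem_of_cellSum_ne_zero {φ : ℝ → ℝ} {a b : ℝ} (hφ : ∀ t, φ t ≠ 0 → t ∈ Set.Icc a b)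
    {h : ℝ} (hh : 0 < h) {w : (Fin d → Fin p) → ℝ} {x : Fin d → ℝ}
    (hx : cellSum (fun _ => φ) h w x ≠ 0) :
    x ∈ Set.Icc (fun _ : Fin d => a * h) (fun _ => (b + p - 1) * h) := by
  obtain ⟨m, -, hm⟩ := Finset.exists_ne_zero_of_sum_ne_zero hx
  have h1 := right_ne_zero_of_mul hm
  rw [Finset.prod_ne_zero_iff] at h1
  have h2 : ∀ l, a + (m l : ℕ) ≤ x l / h ∧ x l / h ≤ b + (m l : ℕ) := fun l => by
    have := hφ _ (h1 l (Finset.mem_univ l))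
    exact ⟨by linarith [this.1], by linarith [this.2]⟩
  refine ⟨fun l => ?_, fun l => ?_⟩
  · have h3 := (le_div_iff₀ hh).mp (h2 l).1
    refine le_trans (mul_le_mul_of_nonneg_right ?_ hh.le) h3
    simp
  · have h3 := (div_le_iff₀ hh).mp (h2 l).2
    refine h3.trans ?_
    have : ((m l : ℕ) : ℝ) + 1 ≤ p := by exact_mod_cast (m l).2
    exact mul_le_mul_of_nonneg_right (by linarith) hh.le

/-- Only one cell contributes at each point. -/
lemma sum_shift_le {φ : ℝ → ℝ} {B : ℝ} (hB : ∀ t, |φ t| ≤ B)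
    (hφ : ∀ t, φ t ≠ 0 → t ∈ Set.Ioo (0 : ℝ) 1) (t : ℝ) :
    ∑ m : Fin p, |φ (t - (m : ℕ))| ≤ B := by
  have hB0 : 0 ≤ B := (abs_nonneg _).trans (hB 0)
  by_cases hex : ∃ m : Fin p, φ (t - (m : ℕ)) ≠ 0
  · obtain ⟨m, hm⟩ := hex
    rw [Finset.sum_eq_single m]
    · exact hB _
    · intro m' _ hne
      rw [abs_eq_zero]
      by_contra hm'
      have h1 := hφ _ hm
      have h2 := hφ _ hm'
      refine hne (Fin.ext ?_)
      have h3 : ((m' : ℕ) : ℝ) < (m : ℕ) + 1 := by linarith [h1.2, h2.1]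
      have h4 : ((m : ℕ) : ℝ) < (m' : ℕ) + 1 := by linarith [h2.2, h1.1]
      have h5 : (m' : ℕ) < (m : ℕ) + 1 := by exact_mod_cast h3
      have h6 : (m : ℕ) < (m' : ℕ) + 1 := by exact_mod_cast h4
      omega
    · simp
  · push Not at hex
    simpa [hex] using hB0

lemma integrable_cell {φ : ℝ → ℝ} (hφ : Integrable φ) {h : ℝ} (hh : 0 < h) (m : Fin d → Fin p) :
    Integrable fun x : Fin d → ℝ => ∏ l, φ (x l / h - (m l : ℕ)) :=
  Integrable.fintype_prod (f := fun l t => φ (t / h - (m l : ℕ)))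
    fun _ => (hφ.comp_sub_right _).comp_div hh.ne'

lemma integrable_cellSum {φ : ℝ → ℝ} (hφ : Integrable φ) {h : ℝ} (hh : 0 < h)
    (w : (Fin d → Fin p) → ℝ) : Integrable (cellSum (fun _ => φ) h w) :=
  integrable_finsetSum _ fun m _ => (integrable_cell hφ hh m).const_mul _

lemma integral_cell (φ : ℝ → ℝ) {h : ℝ} (hh : 0 < h) (m : Fin d → Fin p) :
    ∫ x : Fin d → ℝ, ∏ l, φ (x l / h - (m l : ℕ)) = (h * ∫ t, φ t) ^ d := by
  rw [integral_fintype_prod_volume_eq_prod (f := fun l (t : ℝ) => φ (t / h - (m l : ℕ)))]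
  have : ∀ l : Fin d, ∫ t : ℝ, φ (t / h - (m l : ℕ)) = h * ∫ t, φ t := by
    intro l
    rw [Measure.integral_comp_div (fun t => φ (t - (m l : ℕ))), integral_sub_right_eq_self,
      abs_of_pos hh, smul_eq_mul]
  simp [this]

lemma integral_cellSum {φ : ℝ → ℝ} (hφ : Integrable φ) {h : ℝ} (hh : 0 < h)
    (w : (Fin d → Fin p) → ℝ) :
    ∫ x, cellSum (fun _ => φ) h w x = (∑ m, w m) * (h * ∫ t, φ t) ^ d := by
  unfold cellSum
  rw [integral_finsetSum _ fun m _ => (integrable_cell hφ hh m).const_mul _, Finset.sum_mul]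
  refine Finset.sum_congr rfl fun m _ => ?_
  rw [integral_const_mul, integral_cell φ hh m]

/-- The cells are disjoint, so products of two sums of cells are computed cell by cell. -/
lemma cellSum_mul_cellSum {φ : ℝ → ℝ} (hφ : ∀ t, φ t ≠ 0 → t ∈ Set.Ioo (0 : ℝ) 1) (h : ℝ)
    (w w' : (Fin d → Fin p) → ℝ) (x : Fin d → ℝ) :
    cellSum (fun _ => φ) h w x * cellSum (fun _ => φ) h w' x =
      cellSum (fun _ t => φ t ^ 2) h (fun m => w m * w' m) x := by
  unfold cellSum
  rw [Finset.sum_mul_sum]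
  refine Finset.sum_congr rfl fun m _ => ?_
  rw [Finset.sum_eq_single m]
  · rw [Finset.prod_pow]
    ring
  · intro m' _ hne
    by_contra hz
    have h1 := right_ne_zero_of_mul (left_ne_zero_of_mul hz)
    have h2 := right_ne_zero_of_mul (right_ne_zero_of_mul hz)
    rw [Finset.prod_ne_zero_iff] at h1 h2
    refine hne (funext fun l => Fin.ext ?_)
    have h3 := hφ _ (h1 l (Finset.mem_univ l))
    have h4 := hφ _ (h2 l (Finset.mem_univ l))
    have h5 : ((m' l : ℕ) : ℝ) < (m l : ℕ) + 1 := by linarith [h3.2, h4.1]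
    have h6 : ((m l : ℕ) : ℝ) < (m' l : ℕ) + 1 := by linarith [h4.2, h3.1]
    have h7 : (m' l : ℕ) < (m l : ℕ) + 1 := by exact_mod_cast h5
    have h8 : (m l : ℕ) < (m' l : ℕ) + 1 := by exact_mod_cast h6
    omega
  · simp

/-! ### Testing a density against a finite mixture -/

lemma IsDensity.integrable {d : ℕ} {f : (Fin d → ℝ) → ℝ} (hf : IsDensity f) : Integrable f := by
  refine ⟨hf.measurable.aestronglyMeasurable, ?_⟩
  rw [hasFiniteIntegral_iff_ofReal (Eventually.of_forall hf.nonneg), hf.lintegral_eq_one]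
  exact ENNReal.one_lt_top

lemma IsDensity.integral_eq_one {d : ℕ} {f : (Fin d → ℝ) → ℝ} (hf : IsDensity f) :
    ∫ x, f x = 1 := by
  rw [integral_eq_lintegral_of_nonneg_ae (Eventually.of_forall hf.nonneg)
    hf.measurable.aestronglyMeasurable, hf.lintegral_eq_one, ENNReal.toReal_one]

lemma isDensity_of_integral_eq_one {d : ℕ} {f : (Fin d → ℝ) → ℝ} (hm : Measurable f)
    (h0 : ∀ x, 0 ≤ f x) (hi : Integrable f) (h1 : ∫ x, f x = 1) : IsDensity f where
  measurable := hm
  nonneg := h0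
  lintegral_eq_one := by
    rw [← ofReal_integral_eq_lintegral_ofReal hi (Eventually.of_forall h0), h1, ENNReal.ofReal_one]

lemma lintegral_ofReal_prod_sample {d : ℕ} (n : ℕ) {u : (Fin d → ℝ) → ℝ} (hu : Integrable u)
    (h0 : ∀ x, 0 ≤ u x) :
    ∫⁻ x : Fin n → Fin d → ℝ, ENNReal.ofReal (∏ i, u (x i)) =
      ENNReal.ofReal ((∫ y, u y) ^ n) := by
  rw [← ofReal_integral_eq_lintegral_ofReal]
  · rw [integral_fintype_prod_volume_eq_pow, Fintype.card_fin]
  · exact Integrable.fintype_prod (f := fun _ => u) fun _ => hu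
  · exact Eventually.of_forall fun x => Finset.prod_nonneg fun i _ => h0 _

lemma measurable_prod_sample {d : ℕ} (n : ℕ) {u : (Fin d → ℝ) → ℝ} (hu : Measurable u) :
    Measurable fun x : Fin n → Fin d → ℝ => ∏ i, u (x i) :=
  Finset.measurable_prod _ fun i _ => hu.comp (measurable_pi_apply i)

lemma sq_risk {d : ℕ} (N : Estimator d) (n : ℕ) {f : (Fin d → ℝ) → ℝ} (hf : Measurable f) :
    risk N n f ^ 2 = ∫⁻ x : Fin n → Fin d → ℝ, ENNReal.ofReal (∏ i, f (x i)) *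
      ENNReal.ofReal ((N.toFun n x - (normLp 2 f).toReal) ^ 2) := by
  have h1 : Measurable fun x : Fin n → Fin d → ℝ => ENNReal.ofReal (∏ i, f (x i)) :=
    (measurable_prod_sample n hf).ennreal_ofReal
  have h2 : Measurable fun x : Fin n → Fin d → ℝ =>
      ENNReal.ofReal ((N.toFun n x - (normLp 2 f).toReal) ^ 2) :=
    (((N.measurable n).sub_const _).pow_const 2).ennreal_ofReal
  rw [risk, ← ENNReal.rpow_natCast, ← ENNReal.rpow_mul, sampleLaw,
    lintegral_withDensity_eq_lintegral_mul _ h1 h2]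
  norm_num

/-- The second moment method: if the mixture of the densities `f₀ * g ω` has likelihood ratio of
second moment at most `A` with respect to `f₀`, and all their norms exceed that of `f₀` by `Δ`, an
estimator that is accurate on the scale `Δ` at all `f₀ * g ω` has a risk of order at least
`Δ / √A` at `f₀`. -/
theorem risk_lower_bound_of_mixture {d n : ℕ} {Ω : Type*} [Fintype Ω] [Nonempty Ω]
    (N : Estimator d) {f₀ : (Fin d → ℝ) → ℝ} (hf₀ : IsDensity f₀) {g : Ω → (Fin d → ℝ) → ℝ}
    (hf : ∀ ω, IsDensity fun x => f₀ x * g ω x) (hgm : ∀ ω, Measurable (g ω))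
    (hg0 : ∀ ω x, 0 ≤ g ω x) (hg2 : ∀ ω x, g ω x ≤ 2) {Δ A : ℝ} (hΔ : 0 < Δ) (hA : 0 < A)
    (hnorm : ∀ ω, (normLp 2 fun x => f₀ x * g ω x).toReal = (normLp 2 f₀).toReal + Δ)
    (hmoment : ∑ ω, ∑ ω', (∫ x, f₀ x * (g ω x * g ω' x)) ^ n ≤ A * (Fintype.card Ω : ℝ) ^ 2)
    {R : ℝ≥0∞} (hR : ∀ ω, risk N n (fun x => f₀ x * g ω x) ≤ R) :
    ENNReal.ofReal (Δ / 4) ≤ R ∨ ENNReal.ofReal (Δ / (3 * √A)) ≤ risk N n f₀ := by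
  by_contra hcon
  rw [not_or, not_le, not_le] at hcon
  obtain ⟨hR1, hR0⟩ := hcon
  set c : ℝ := (Fintype.card Ω : ℝ) with hc
  have hc0 : 0 < c := by rw [hc]; exact_mod_cast Fintype.card_pos
  set t₀ := (normLp 2 f₀).toReal with ht₀
  -- the likelihoods at `f₀`, at the alternatives, and the second moment integrand
  set W : (Fin n → Fin d → ℝ) → ℝ := fun x => ∏ i, f₀ (x i) with hW
  set P : Ω → (Fin n → Fin d → ℝ) → ℝ := fun ω x => ∏ i, (f₀ (x i) * g ω (x i)) with hP
  set q : Ω → Ω → (Fin n → Fin d → ℝ) → ℝ :=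
    fun ω ω' x => ∏ i, (f₀ (x i) * (g ω (x i) * g ω' (x i))) with hq
  have hW0 : ∀ x, 0 ≤ W x := fun x => Finset.prod_nonneg fun i _ => hf₀.nonneg _
  have hP0 : ∀ ω x, 0 ≤ P ω x := fun ω x => Finset.prod_nonneg fun i _ => (hf ω).nonneg _
  have hqn : ∀ ω ω' x, 0 ≤ f₀ x * (g ω x * g ω' x) := fun ω ω' x =>
    mul_nonneg (hf₀.nonneg x) (mul_nonneg (hg0 ω x) (hg0 ω' x))
  have hq0 : ∀ ω ω' x, 0 ≤ q ω ω' x := fun ω ω' x => Finset.prod_nonneg fun i _ => hqn ω ω' _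
  have hqm : ∀ ω ω', Measurable fun x => f₀ x * (g ω x * g ω' x) := fun ω ω' =>
    hf₀.measurable.mul ((hgm ω).mul (hgm ω'))
  have hqi : ∀ ω ω', Integrable fun x => f₀ x * (g ω x * g ω' x) := by
    intro ω ω'
    refine (hf₀.integrable.const_mul 4).mono' (hqm ω ω').aestronglyMeasurable
      (Eventually.of_forall fun x => ?_)
    rw [Real.norm_of_nonneg (hqn ω ω' x), mul_comm 4]
    refine mul_le_mul_of_nonneg_left ?_ (hf₀.nonneg x)
    nlinarith [hg0 ω x, hg0 ω' x, hg2 ω x, hg2 ω' x]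
  have hN1 : Measurable fun x => N.toFun n x := N.measurable n
  have hPm : ∀ ω, Measurable (P ω) := fun ω => measurable_prod_sample n (hf ω).measurable
  have hWm : Measurable W := measurable_prod_sample n hf₀.measurable
  have hqmm : ∀ ω ω', Measurable (q ω ω') := fun ω ω' => measurable_prod_sample n (hqm ω ω')
  have hsq : ∀ x, (∑ ω, P ω x) ^ 2 = W x * ∑ ω, ∑ ω', q ω ω' x := by
    intro x
    rw [sq, Finset.sum_mul_sum, Finset.mul_sum]
    refine Finset.sum_congr rfl fun ω _ => ?_
    rw [Finset.mul_sum]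
    refine Finset.sum_congr rfl fun ω' _ => ?_
    simp only [hP, hW, hq]
    rw [← Finset.prod_mul_distrib, ← Finset.prod_mul_distrib]
    exact Finset.prod_congr rfl fun i _ => by ring
  have hpt : ∀ x, ∑ ω, P ω x ≤
      4 / Δ ^ 2 * ∑ ω, P ω x * (N.toFun n x - (t₀ + Δ)) ^ 2 +
      (4 * c * A / Δ ^ 2 * (W x * (N.toFun n x - t₀) ^ 2) +
        1 / (4 * c * A) * ∑ ω, ∑ ω', q ω ω' x) := by
    intro x
    have hF0 : 0 ≤ ∑ ω, P ω x := Finset.sum_nonneg fun ω _ => hP0 ω x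
    have hQ0 : 0 ≤ ∑ ω, ∑ ω', q ω ω' x :=
      Finset.sum_nonneg fun ω _ => Finset.sum_nonneg fun ω' _ => hq0 ω ω' x
    rw [← Finset.sum_mul]
    have hs := hsq x
    have hw := hW0 x
    generalize (∑ ω, P ω x) = F at *
    generalize (∑ ω, ∑ ω', q ω ω' x) = Q at *
    generalize W x = w at *
    rcases le_or_gt (Δ ^ 2 / 4) ((N.toFun n x - (t₀ + Δ)) ^ 2) with h | h
    · have h1 : F ≤ 4 / Δ ^ 2 * (F * (N.toFun n x - (t₀ + Δ)) ^ 2) := by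
        calc F = 4 / Δ ^ 2 * (F * (Δ ^ 2 / 4)) := by field_simp
          _ ≤ _ := by gcongr
      have h2 : 0 ≤ 4 * c * A / Δ ^ 2 * (w * (N.toFun n x - t₀) ^ 2) := by positivity
      have h3 : 0 ≤ 1 / (4 * c * A) * Q := by positivity
      linarith
    · have h4 : Δ ^ 2 / 4 ≤ (N.toFun n x - t₀) ^ 2 := by
        have h5 : |N.toFun n x - (t₀ + Δ)| < Δ / 2 := by
          rw [← abs_of_pos (half_pos hΔ), ← sq_lt_sq]
          linarith [h, show (Δ / 2) ^ 2 = Δ ^ 2 / 4 by ring]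
        have h6 := (abs_lt.mp h5).1
        have h7 : Δ / 2 ≤ N.toFun n x - t₀ := by linarith
        calc Δ ^ 2 / 4 = (Δ / 2) ^ 2 := by ring
          _ ≤ _ := by gcongr
      have h1 : c * A * w ≤ 4 * c * A / Δ ^ 2 * (w * (N.toFun n x - t₀) ^ 2) := by
        calc c * A * w = 4 * c * A / Δ ^ 2 * (w * (Δ ^ 2 / 4)) := by field_simp
          _ ≤ _ := by gcongr
      have h2 : 0 ≤ 4 / Δ ^ 2 * (F * (N.toFun n x - (t₀ + Δ)) ^ 2) := by positivity
      -- the inequality of arithmetic and geometric means, as `F ^ 2 = w * Q`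
      have h3 : F ≤ c * A * w + 1 / (4 * c * A) * Q := by
        refine abs_le_of_sq_le_sq' (a := F) ?_ (by positivity) |>.2
        rw [hs]
        have : w * Q = 4 * (c * A * w) * (1 / (4 * c * A) * Q) := by field_simp
        rw [this]
        nlinarith [sq_nonneg (c * A * w - 1 / (4 * c * A) * Q)]
      linarith
  have hint : ∫⁻ x, ENNReal.ofReal (∑ ω, P ω x) = ENNReal.ofReal c := by
    simp_rw [fun x => ENNReal.ofReal_sum_of_nonneg (fun ω (_ : ω ∈ Finset.univ) => hP0 ω x)]
    rw [lintegral_finsetSum _ fun ω _ => (measurable_prod_sample n (hf ω).measurable).ennreal_ofReal]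
    have h1 : ∀ ω, ∫⁻ x, ENNReal.ofReal (P ω x) = 1 := by
      intro ω
      rw [lintegral_ofReal_prod_sample n (hf ω).integrable (hf ω).nonneg, (hf ω).integral_eq_one]
      simp
    rw [Finset.sum_congr rfl fun ω _ => h1 ω]
    simp [hc]
  have hone : ∫⁻ x, ENNReal.ofReal (∑ ω, P ω x * (N.toFun n x - (t₀ + Δ)) ^ 2) ≤
      ENNReal.ofReal (c * (Δ / 4) ^ 2) := by
    simp_rw [fun x => ENNReal.ofReal_sum_of_nonneg
      (fun ω (_ : ω ∈ Finset.univ) => mul_nonneg (hP0 ω x) (sq_nonneg (N.toFun n x - (t₀ + Δ)))),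
      fun ω x => ENNReal.ofReal_mul (q := (N.toFun n x - (t₀ + Δ)) ^ 2) (hP0 ω x)]
    rw [lintegral_finsetSum _ fun ω _ => by fun_prop]
    have h1 : ∀ ω ∈ Finset.univ, ∫⁻ x, ENNReal.ofReal (P ω x) *
        ENNReal.ofReal ((N.toFun n x - (t₀ + Δ)) ^ 2) ≤ ENNReal.ofReal (Δ / 4) ^ 2 := by
      intro ω _
      have h2 := sq_risk N n (hf ω).measurable
      rw [hnorm ω] at h2
      rw [← h2]
      gcongr
      exact (hR ω).trans hR1.le
    refine (Finset.sum_le_card_nsmul _ _ _ h1).trans (le_of_eq ?_)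
    rw [ENNReal.ofReal_mul hc0.le, ENNReal.ofReal_pow (by positivity), nsmul_eq_mul, hc,
      ENNReal.ofReal_natCast, Finset.card_univ]
  have htwo : ∫⁻ x, ENNReal.ofReal (W x * (N.toFun n x - t₀) ^ 2) ≤
      ENNReal.ofReal (Δ ^ 2 / (9 * A)) := by
    simp_rw [fun x => ENNReal.ofReal_mul (q := (N.toFun n x - t₀) ^ 2) (hW0 x)]
    rw [← sq_risk N n hf₀.measurable]
    calc risk N n f₀ ^ 2 ≤ ENNReal.ofReal (Δ / (3 * √A)) ^ 2 := by gcongr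
      _ = ENNReal.ofReal (Δ ^ 2 / (9 * A)) := by
        rw [← ENNReal.ofReal_pow (by positivity), div_pow, mul_pow, Real.sq_sqrt hA.le]
        norm_num
  have hthree : ∫⁻ x, ENNReal.ofReal (∑ ω, ∑ ω', q ω ω' x) ≤ ENNReal.ofReal (A * c ^ 2) := by
    have h1 : ∀ x, ENNReal.ofReal (∑ ω, ∑ ω', q ω ω' x) =
        ∑ ω, ∑ ω', ENNReal.ofReal (q ω ω' x) := by
      intro x
      rw [ENNReal.ofReal_sum_of_nonneg fun ω _ => Finset.sum_nonneg fun ω' _ => hq0 ω ω' x]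
      exact Finset.sum_congr rfl fun ω _ =>
        ENNReal.ofReal_sum_of_nonneg fun ω' _ => hq0 ω ω' x
    rw [lintegral_congr h1, lintegral_finsetSum _ fun ω _ => by fun_prop]
    refine le_trans (le_of_eq ?_) (ENNReal.ofReal_le_ofReal hmoment)
    rw [ENNReal.ofReal_sum_of_nonneg fun ω _ => Finset.sum_nonneg fun ω' _ =>
      pow_nonneg (integral_nonneg (hqn ω ω')) n]
    refine Finset.sum_congr rfl fun ω _ => ?_
    rw [lintegral_finsetSum _ fun ω' _ => (hqmm ω ω').ennreal_ofReal,
      ENNReal.ofReal_sum_of_nonneg fun ω' _ => pow_nonneg (integral_nonneg (hqn ω ω')) n]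
    exact Finset.sum_congr rfl fun ω' _ => lintegral_ofReal_prod_sample n (hqi ω ω') (hqn ω ω')
  have hfin : ENNReal.ofReal c ≤ ENNReal.ofReal (4 / Δ ^ 2) * ENNReal.ofReal (c * (Δ / 4) ^ 2) +
      (ENNReal.ofReal (4 * c * A / Δ ^ 2) * ENNReal.ofReal (Δ ^ 2 / (9 * A)) +
        ENNReal.ofReal (1 / (4 * c * A)) * ENNReal.ofReal (A * c ^ 2)) := by
    rw [← hint]
    have hm1 : Measurable fun x => ENNReal.ofReal (∑ ω, P ω x * (N.toFun n x - (t₀ + Δ)) ^ 2) := by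
      fun_prop
    have hm2 : Measurable fun x => ENNReal.ofReal (W x * (N.toFun n x - t₀) ^ 2) := by
      fun_prop
    have hm3 : Measurable fun x => ENNReal.ofReal (∑ ω, ∑ ω', q ω ω' x) := by
      fun_prop
    calc ∫⁻ x, ENNReal.ofReal (∑ ω, P ω x)
        ≤ ∫⁻ x, (ENNReal.ofReal (4 / Δ ^ 2) *
            ENNReal.ofReal (∑ ω, P ω x * (N.toFun n x - (t₀ + Δ)) ^ 2) +
          (ENNReal.ofReal (4 * c * A / Δ ^ 2) * ENNReal.ofReal (W x * (N.toFun n x - t₀) ^ 2) +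
            ENNReal.ofReal (1 / (4 * c * A)) * ENNReal.ofReal (∑ ω, ∑ ω', q ω ω' x))) := by
          refine lintegral_mono fun x => ?_
          refine (ENNReal.ofReal_le_ofReal (hpt x)).trans ?_
          refine ENNReal.ofReal_add_le.trans (add_le_add (le_of_eq ?_)
            (ENNReal.ofReal_add_le.trans (add_le_add (le_of_eq ?_) (le_of_eq ?_))))
          all_goals rw [ENNReal.ofReal_mul (by positivity)]
      _ = ENNReal.ofReal (4 / Δ ^ 2) *
            (∫⁻ x, ENNReal.ofReal (∑ ω, P ω x * (N.toFun n x - (t₀ + Δ)) ^ 2)) +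
          (ENNReal.ofReal (4 * c * A / Δ ^ 2) *
            (∫⁻ x, ENNReal.ofReal (W x * (N.toFun n x - t₀) ^ 2)) +
          ENNReal.ofReal (1 / (4 * c * A)) * ∫⁻ x, ENNReal.ofReal (∑ ω, ∑ ω', q ω ω' x)) := by
          rw [lintegral_add_left (hm1.const_mul _), lintegral_add_left (hm2.const_mul _),
            lintegral_const_mul _ hm1, lintegral_const_mul _ hm2, lintegral_const_mul _ hm3]
      _ ≤ _ := by gcongr
  rw [← ENNReal.ofReal_mul (by positivity), ← ENNReal.ofReal_mul (by positivity),
    ← ENNReal.ofReal_mul (by positivity), ← ENNReal.ofReal_add (by positivity) (by positivity),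
    ← ENNReal.ofReal_add (by positivity) (by positivity),
    ENNReal.ofReal_le_ofReal_iff (by positivity)] at hfin
  have hval : 4 / Δ ^ 2 * (c * (Δ / 4) ^ 2) + (4 * c * A / Δ ^ 2 * (Δ ^ 2 / (9 * A)) +
      1 / (4 * c * A) * (A * c ^ 2)) = 17 / 18 * c := by
    field_simp
    ring
  rw [hval] at hfin
  linarith

/-! ### Random signs -/

/-- The sign `±1` encoded by a truth value. -/
def sign (s : Bool) : ℝ := if s then 1 else -1

lemma abs_sign (s : Bool) : |sign s| = 1 := by cases s <;> simp [sign]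

lemma sign_mul_self (s : Bool) : sign s * sign s = 1 := by cases s <;> simp [sign]

/-- The exponential moment of the inner product of two independent vectors of random signs. -/
lemma sum_exp_sign_le {ι : Type*} [Fintype ι] [DecidableEq ι] (c : ℝ) :
    ∑ ω : ι → Bool, ∑ ω' : ι → Bool, Real.exp (c * ∑ m, sign (ω m) * sign (ω' m)) ≤
      Real.exp (Fintype.card ι * c ^ 2 / 2) * (Fintype.card (ι → Bool) : ℝ) ^ 2 := by
  have h1 : ∀ ω : ι → Bool, ∑ ω' : ι → Bool, Real.exp (c * ∑ m, sign (ω m) * sign (ω' m)) =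
      (2 * Real.cosh c) ^ Fintype.card ι := by
    intro ω
    have h2 : ∀ ω' : ι → Bool, Real.exp (c * ∑ m, sign (ω m) * sign (ω' m)) =
        ∏ m, Real.exp (c * (sign (ω m) * sign (ω' m))) := by
      intro ω'
      rw [Finset.mul_sum, Real.exp_sum]
    simp_rw [h2]
    rw [← Fintype.piFinset_univ,
      ← Finset.prod_univ_sum (fun _ => Finset.univ) fun m s => Real.exp (c * (sign (ω m) * sign s))]
    have h3 : ∀ m, ∑ s : Bool, Real.exp (c * (sign (ω m) * sign s)) = 2 * Real.cosh c := by
      intro m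
      rw [Real.cosh_eq]
      cases ω m <;> simp [sign] <;> ring
    rw [Finset.prod_congr rfl fun m _ => h3 m, Finset.prod_const, Finset.card_univ]
  simp_rw [h1]
  rw [Finset.sum_const, Finset.card_univ, nsmul_eq_mul, mul_pow]
  have h4 : Real.cosh c ^ Fintype.card ι ≤ Real.exp (Fintype.card ι * c ^ 2 / 2) := by
    refine (pow_le_pow_left₀ (Real.cosh_pos c).le (Real.cosh_le_exp_half_sq c) _).trans
      (le_of_eq ?_)
    rw [← Real.exp_nat_mul]
    congr 1
    ring
  have h5 : (Fintype.card (ι → Bool) : ℝ) = 2 ^ Fintype.card ι := by simp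
  rw [h5]
  calc (2 : ℝ) ^ Fintype.card ι * (2 ^ Fintype.card ι * Real.cosh c ^ Fintype.card ι)
      ≤ 2 ^ Fintype.card ι * (2 ^ Fintype.card ι * Real.exp (Fintype.card ι * c ^ 2 / 2)) := by
        gcongr
    _ = _ := by ring

/-! ### Perturbation of a density on a cube where it is constant -/

lemma toReal_normLp_two {d : ℕ} {f : (Fin d → ℝ) → ℝ} (hf : Measurable f)
    (hi : Integrable fun x => f x ^ 2) : (normLp 2 f).toReal = √(∫ x, f x ^ 2) := by
  have hm : MemLp f 2 := (memLp_two_iff_integrable_sq hf.aestronglyMeasurable).mpr hi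
  rw [normLp, if_neg ENNReal.ofNat_ne_top,
    hm.eLpNorm_eq_integral_rpow_norm two_ne_zero ENNReal.ofNat_ne_top]
  rw [ENNReal.toReal_ofReal (by positivity), Real.sqrt_eq_rpow]
  simp

lemma integrable_sq_of_hasCompactSupport {φ : ℝ → ℝ} (hφ : Continuous φ)
    (hφc : HasCompactSupport φ) : Integrable fun t => φ t ^ 2 := by
  have h1 : Continuous fun t => φ t ^ 2 := by fun_prop
  have h2 : HasCompactSupport fun t => φ t ^ 2 := by
    simp_rw [sq]
    exact hφc.mul_left
  exact h1.integrable_of_hasCompactSupport h2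

section Perturbation

variable {d p : ℕ} {φ : ℝ → ℝ}

/-- The relative perturbation with signs `ω` and amplitude `ρ` on the grid of cells. -/
noncomputable def perturbation (φ : ℝ → ℝ) (h ρ : ℝ) (ω : (Fin d → Fin p) → Bool)
    (x : Fin d → ℝ) : ℝ :=
  1 + ρ * cellSum (fun _ => φ) h (fun m => sign (ω m)) x

lemma abs_cellSum_sign_le (hφ1 : ∀ t, |φ t| ≤ 1) (hφ0 : ∀ t, φ t ≠ 0 → t ∈ Set.Ioo (0 : ℝ) 1)
    (h : ℝ) (ω : (Fin d → Fin p) → Bool) (x : Fin d → ℝ) :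
    |cellSum (fun _ => φ) h (fun m => sign (ω m)) x| ≤ 1 := by
  have := abs_cellSum_le (φ := fun _ : Fin d => φ) (B := 1) (fun _ => sum_shift_le hφ1 hφ0)
    (w := fun m => sign (ω m)) (fun m => (abs_sign _).le) h x
  simpa using this

lemma abs_perturbation_sub_one_le (hφ1 : ∀ t, |φ t| ≤ 1)
    (hφ0 : ∀ t, φ t ≠ 0 → t ∈ Set.Ioo (0 : ℝ) 1) {ρ : ℝ} (hρ0 : 0 ≤ ρ) (hρ1 : ρ ≤ 1)
    (h : ℝ) (ω : (Fin d → Fin p) → Bool) (x : Fin d → ℝ) :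
    |perturbation φ h ρ ω x - 1| ≤ 1 := by
  rw [perturbation, add_sub_cancel_left, abs_mul, abs_of_nonneg hρ0]
  exact mul_le_one₀ hρ1 (abs_nonneg _) (abs_cellSum_sign_le hφ1 hφ0 h ω x)

lemma mul_cellSum_of_flat (hφ0 : ∀ t, φ t ≠ 0 → t ∈ Set.Ioo (0 : ℝ) 1) {h S a : ℝ} (hh : 0 < h)
    (hS : S = p * h) {f₀ : (Fin d → ℝ) → ℝ}
    (hflat : ∀ x ∈ Set.Icc (fun _ : Fin d => (0 : ℝ)) (fun _ => S), f₀ x = a)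
    (w : (Fin d → Fin p) → ℝ) (x : Fin d → ℝ) :
    f₀ x * cellSum (fun _ => φ) h w x = a * cellSum (fun _ => φ) h w x := by
  by_cases hx : cellSum (fun _ => φ) h w x = 0
  · rw [hx, mul_zero, mul_zero]
  · have h1 := mem_of_cellSum_ne_zero (a := 0) (b := 1)
      (fun t ht => Set.Ioo_subset_Icc_self (hφ0 t ht)) hh hx
    rw [hflat x]
    rw [hS]
    simpa using h1

lemma integral_mul_perturbation (hφ : Continuous φ) (hφc : HasCompactSupport φ)
    (hφi : ∫ t, φ t = 0) (hd : d ≠ 0)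
    (hφ0 : ∀ t, φ t ≠ 0 → t ∈ Set.Ioo (0 : ℝ) 1) {h S a ρ : ℝ} (hh : 0 < h) (hS : S = p * h)
    {f₀ : (Fin d → ℝ) → ℝ} (hf₀ : Integrable f₀)
    (hflat : ∀ x ∈ Set.Icc (fun _ : Fin d => (0 : ℝ)) (fun _ => S), f₀ x = a)
    (ω ω' : (Fin d → Fin p) → Bool) :
    Integrable (fun x => f₀ x * (perturbation φ h ρ ω x * perturbation φ h ρ ω' x)) ∧
    ∫ x, f₀ x * (perturbation φ h ρ ω x * perturbation φ h ρ ω' x) =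
      (∫ x, f₀ x) + ρ ^ 2 * a * (h * ∫ t, φ t ^ 2) ^ d * ∑ m, sign (ω m) * sign (ω' m) := by
  have hi : Integrable φ := hφ.integrable_of_hasCompactSupport hφc
  have hi2 : Integrable fun t => φ t ^ 2 :=
    integrable_sq_of_hasCompactSupport hφ hφc
  have hexp : ∀ x, f₀ x * (perturbation φ h ρ ω x * perturbation φ h ρ ω' x) =
      f₀ x + (ρ * a * cellSum (fun _ => φ) h (fun m => sign (ω m)) x +
        (ρ * a * cellSum (fun _ => φ) h (fun m => sign (ω' m)) x +
        ρ ^ 2 * a * cellSum (fun _ t => φ t ^ 2) h (fun m => sign (ω m) * sign (ω' m)) x)) := by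
    intro x
    rw [← cellSum_mul_cellSum hφ0]
    simp only [perturbation]
    have h1 := mul_cellSum_of_flat hφ0 hh hS hflat (fun m => sign (ω m)) x
    have h2 := mul_cellSum_of_flat hφ0 hh hS hflat (fun m => sign (ω' m)) x
    linear_combination ρ * h1 + (ρ + ρ ^ 2 * cellSum (fun _ => φ) h (fun m => sign (ω m)) x) * h2
  have i1 : ∀ w : (Fin d → Fin p) → ℝ,
      Integrable fun x => ρ * a * cellSum (fun _ => φ) h w x := fun w =>
    (integrable_cellSum hi hh w).const_mul _
  have i2 : ∀ w : (Fin d → Fin p) → ℝ,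
      Integrable fun x => ρ ^ 2 * a * cellSum (fun _ t => φ t ^ 2) h w x := fun w =>
    (integrable_cellSum hi2 hh w).const_mul _
  have key : ∀ A B C : (Fin d → ℝ) → ℝ, Integrable A → Integrable B → Integrable C →
      Integrable (fun x => f₀ x + (A x + (B x + C x))) ∧
      ∫ x, (f₀ x + (A x + (B x + C x))) =
        (∫ x, f₀ x) + ((∫ x, A x) + ((∫ x, B x) + ∫ x, C x)) := by
    intro A B C hA hB hC
    have hBC : Integrable fun x => B x + C x := hB.add hC
    have hABC : Integrable fun x => A x + (B x + C x) := hA.add hBC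
    exact ⟨hf₀.add hABC, by
      rw [integral_add hf₀ hABC, integral_add hA hBC, integral_add hB hC]⟩
  obtain ⟨k1, k2⟩ := key _ _ _ (i1 fun m => sign (ω m)) (i1 fun m => sign (ω' m))
    (i2 fun m => sign (ω m) * sign (ω' m))
  refine ⟨k1.congr (Eventually.of_forall fun x => (hexp x).symm), ?_⟩
  rw [integral_congr_ae (Eventually.of_forall hexp), k2, integral_const_mul, integral_const_mul,
    integral_const_mul, integral_cellSum hi hh, integral_cellSum hi hh, integral_cellSum hi2 hh,
    hφi, mul_zero, zero_pow hd]
  ring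

/-- The alternatives are obtained by perturbing `f₀`, with random signs, on the `p ^ d` cells of
a cube of side `S` on which `f₀` is constant. The unit of the `L₂`-norm is `a * S ^ (d / 2)`, the
norm of the restriction of `f₀` to this cube, and it is assumed that the norm of `f₀` is at most
`D` units. -/
theorem maxRisk_lower_bound_of_flat (hφ : Continuous φ) (hφc : HasCompactSupport φ)
    (hφi : ∫ t, φ t = 0) (hd : d ≠ 0) (hφ1 : ∀ t, |φ t| ≤ 1)
    (hφ0 : ∀ t, φ t ≠ 0 → t ∈ Set.Ioo (0 : ℝ) 1) (hφ2 : 0 < ∫ t, φ t ^ 2)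
    {h S a ρ Λ D : ℝ} (hh : 0 < h) (hp : p ≠ 0) (hS : S = p * h) (ha : 0 < a) (hρ0 : 0 < ρ)
    (hρ1 : ρ ≤ 1) (hD : 0 ≤ D)
    {f₀ : (Fin d → ℝ) → ℝ} (hf₀ : IsDensity f₀) (hf₀i : Integrable fun x => f₀ x ^ 2)
    (hflat : ∀ x ∈ Set.Icc (fun _ : Fin d => (0 : ℝ)) (fun _ => S), f₀ x = a)
    (hf₀D : ∫ x, f₀ x ^ 2 ≤ D ^ 2 * (a ^ 2 * S ^ d)) (N : Estimator d) {n : ℕ}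
    (hΛ : (n : ℝ) ^ 2 * (a ^ 2 * S ^ d) * h ^ d ≤ Λ) {F F' : Set ((Fin d → ℝ) → ℝ)}
    (hF' : f₀ ∈ F')
    (hF : ∀ ω : (Fin d → Fin p) → Bool, (fun x => f₀ x * perturbation φ h ρ ω x) ∈ F) :
    ENNReal.ofReal (ρ ^ 2 * (∫ t, φ t ^ 2) ^ d / (2 * D + 1) * √(a ^ 2 * S ^ d) / 4) ≤
        maxRisk N n F ∨
      ENNReal.ofReal (ρ ^ 2 * (∫ t, φ t ^ 2) ^ d / (2 * D + 1) * √(a ^ 2 * S ^ d) /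
        (3 * Real.exp (ρ ^ 4 * Λ / 4))) ≤ maxRisk N n F' := by
  have hp0 : (0 : ℝ) < p := by exact_mod_cast Nat.pos_of_ne_zero hp
  have hS0 : 0 < S := by rw [hS]; positivity
  set v : ℝ := ∫ t, φ t ^ 2 with hv
  have hv1 : v ≤ 1 := by
    have hsub : ∀ t, φ t ^ 2 ≤ (Set.Icc (0 : ℝ) 1).indicator (fun _ => (1 : ℝ)) t := by
      intro t
      by_cases ht : t ∈ Set.Icc (0 : ℝ) 1
      · rw [Set.indicator_of_mem ht]
        exact (sq_le_one_iff_abs_le_one _).mpr (hφ1 t)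
      · rw [Set.indicator_of_notMem ht]
        have : φ t = 0 := by_contra fun h => ht (Set.Ioo_subset_Icc_self (hφ0 t h))
        simp [this]
    calc v ≤ ∫ t, (Set.Icc (0 : ℝ) 1).indicator (fun _ => (1 : ℝ)) t :=
          integral_mono_of_nonneg (Eventually.of_forall fun t => sq_nonneg _)
            ((integrable_indicator_iff measurableSet_Icc).mpr (by simp))
            (Eventually.of_forall hsub)
      _ = 1 := by rw [integral_indicator measurableSet_Icc]; simp
  have hgm : ∀ ω : (Fin d → Fin p) → Bool, Measurable (perturbation φ h ρ ω) := fun ω =>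
    (((continuous_cellSum (fun _ => hφ) h _).measurable).const_mul ρ).const_add 1
  have hgb : ∀ (ω : (Fin d → Fin p) → Bool) x, |perturbation φ h ρ ω x - 1| ≤ 1 := fun ω x =>
    abs_perturbation_sub_one_le hφ1 hφ0 hρ0.le hρ1 h ω x
  have hg0 : ∀ (ω : (Fin d → Fin p) → Bool) x, 0 ≤ perturbation φ h ρ ω x := fun ω x => by
    linarith [(abs_le.mp (hgb ω x)).1]
  have hg2 : ∀ (ω : (Fin d → Fin p) → Bool) x, perturbation φ h ρ ω x ≤ 2 := fun ω x => by
    linarith [(abs_le.mp (hgb ω x)).2]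
  have hden : ∀ ω : (Fin d → Fin p) → Bool, IsDensity fun x => f₀ x * perturbation φ h ρ ω x := by
    intro ω
    have hi : Integrable φ := hφ.integrable_of_hasCompactSupport hφc
    have hexp : (fun x => f₀ x * perturbation φ h ρ ω x) = fun x =>
        f₀ x + ρ * a * cellSum (fun _ => φ) h (fun m => sign (ω m)) x := by
      ext x
      have h1 := mul_cellSum_of_flat hφ0 hh hS hflat (fun m => sign (ω m)) x
      simp only [perturbation]
      linear_combination ρ * h1
    have hi1 : Integrable fun x => ρ * a * cellSum (fun _ => φ) h (fun m => sign (ω m)) x :=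
      (integrable_cellSum hi hh _).const_mul _
    refine isDensity_of_integral_eq_one (hf₀.measurable.mul (hgm ω))
      (fun x => mul_nonneg (hf₀.nonneg x) (hg0 ω x)) ?_ ?_
    · rw [hexp]
      exact hf₀.integrable.add hi1
    · rw [hexp, integral_add hf₀.integrable hi1, integral_const_mul, integral_cellSum hi hh, hφi,
        hf₀.integral_eq_one, mul_zero, zero_pow hd]
      simp
  -- the squared norm of every alternative
  set G : ℝ := ρ ^ 2 * v ^ d * (a ^ 2 * S ^ d) with hG
  have hG0 : 0 < G := by positivity
  have hnorm2 : ∀ ω : (Fin d → Fin p) → Bool,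
      Integrable (fun x => (f₀ x * perturbation φ h ρ ω x) ^ 2) ∧
      ∫ x, (f₀ x * perturbation φ h ρ ω x) ^ 2 = (∫ x, f₀ x ^ 2) + G := by
    intro ω
    have h1 := integral_mul_perturbation (ρ := ρ) (a := a ^ 2) (f₀ := fun x => f₀ x ^ 2) hφ hφc
      hφi hd hφ0 hh hS hf₀i (fun x hx => by rw [hflat x hx]) ω ω
    have h2 : (fun x => (f₀ x * perturbation φ h ρ ω x) ^ 2) = fun x =>
        f₀ x ^ 2 * (perturbation φ h ρ ω x * perturbation φ h ρ ω x) := by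
      ext x
      ring
    rw [h2]
    refine ⟨h1.1, h1.2.trans ?_⟩
    simp only [sign_mul_self, Finset.sum_const, Finset.card_univ, Fintype.card_pi_const,
      Fintype.card_fin, nsmul_eq_mul, hG, hS, mul_pow]
    push_cast
    ring
  set t₀ : ℝ := √(∫ x, f₀ x ^ 2) with ht₀
  have hI0 : 0 ≤ ∫ x, f₀ x ^ 2 := integral_nonneg fun x => sq_nonneg _
  set Δ : ℝ := √((∫ x, f₀ x ^ 2) + G) - t₀ with hΔ
  set y : ℝ := √(a ^ 2 * S ^ d) with hy
  have hy0 : 0 < y := Real.sqrt_pos.mpr (by positivity)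
  have hy2 : y ^ 2 = a ^ 2 * S ^ d := Real.sq_sqrt (by positivity)
  have hδ : ρ ^ 2 * v ^ d / (2 * D + 1) * y ≤ Δ := by
    have h1 : t₀ ≤ D * y := by
      refine Real.sqrt_le_iff.mpr ⟨by positivity, ?_⟩
      rw [mul_pow, hy2]
      exact hf₀D
    have h2 : √((∫ x, f₀ x ^ 2) + G) ≤ t₀ + y := by
      refine Real.sqrt_le_iff.mpr ⟨by positivity, ?_⟩
      have h3 : G ≤ y ^ 2 := by
        rw [hy2, hG]
        refine mul_le_of_le_one_left (by positivity) ?_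
        exact mul_le_one₀ (pow_le_one₀ hρ0.le hρ1) (by positivity) (pow_le_one₀ hφ2.le hv1)
      have h4 : t₀ ^ 2 = ∫ x, f₀ x ^ 2 := Real.sq_sqrt hI0
      nlinarith [Real.sqrt_nonneg (∫ x, f₀ x ^ 2)]
    have h5 : Δ * (√((∫ x, f₀ x ^ 2) + G) + t₀) = G := by
      have h6 : √((∫ x, f₀ x ^ 2) + G) ^ 2 = (∫ x, f₀ x ^ 2) + G := Real.sq_sqrt (by linarith)
      have h4 : t₀ ^ 2 = ∫ x, f₀ x ^ 2 := Real.sq_sqrt hI0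
      rw [hΔ]
      linear_combination h6 - h4
    have h7 : 0 ≤ Δ := by
      rw [hΔ, sub_nonneg]
      exact Real.sqrt_le_sqrt (by linarith)
    have h8 : G ≤ Δ * ((2 * D + 1) * y) := by
      rw [← h5]
      refine mul_le_mul_of_nonneg_left ?_ h7
      linarith
    rw [div_mul_eq_mul_div, div_le_iff₀ (by positivity)]
    refine le_of_mul_le_mul_right ?_ hy0
    calc ρ ^ 2 * v ^ d * y * y = G := by rw [hG, ← hy2]; ring
      _ ≤ _ := h8
      _ = _ := by ring
  have hδ0 : 0 < ρ ^ 2 * v ^ d / (2 * D + 1) * y := by positivity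
  have hnorm : ∀ ω : (Fin d → Fin p) → Bool,
      (normLp 2 fun x => f₀ x * perturbation φ h ρ ω x).toReal = (normLp 2 f₀).toReal + Δ := by
    intro ω
    rw [toReal_normLp_two (hden ω).measurable (hnorm2 ω).1, (hnorm2 ω).2,
      toReal_normLp_two hf₀.measurable hf₀i, hΔ]
    ring
  have hmom : ∑ ω : (Fin d → Fin p) → Bool, ∑ ω' : (Fin d → Fin p) → Bool,
      (∫ x, f₀ x * (perturbation φ h ρ ω x * perturbation φ h ρ ω' x)) ^ n ≤
      Real.exp (ρ ^ 4 * Λ / 2) * (Fintype.card ((Fin d → Fin p) → Bool) : ℝ) ^ 2 := by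
    set c : ℝ := n * (ρ ^ 2 * a * (h * v) ^ d) with hc
    have h1 : ∀ ω ω' : (Fin d → Fin p) → Bool,
        (∫ x, f₀ x * (perturbation φ h ρ ω x * perturbation φ h ρ ω' x)) ^ n ≤
        Real.exp (c * ∑ m, sign (ω m) * sign (ω' m)) := by
      intro ω ω'
      have h0 : 0 ≤ ∫ x, f₀ x * (perturbation φ h ρ ω x * perturbation φ h ρ ω' x) :=
        integral_nonneg fun x => mul_nonneg (hf₀.nonneg x) (mul_nonneg (hg0 ω x) (hg0 ω' x))
      have h2 := (integral_mul_perturbation (ρ := ρ) hφ hφc hφi hd hφ0 hh hS hf₀.integrable hflat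
        ω ω').2
      rw [hf₀.integral_eq_one] at h2
      have h3 : ∫ x, f₀ x * (perturbation φ h ρ ω x * perturbation φ h ρ ω' x) ≤
          Real.exp (ρ ^ 2 * a * (h * v) ^ d * ∑ m, sign (ω m) * sign (ω' m)) := by
        rw [h2, add_comm]
        exact Real.add_one_le_exp _
      refine (pow_le_pow_left₀ h0 h3 n).trans (le_of_eq ?_)
      rw [← Real.exp_nat_mul, hc]
      congr 1
      ring
    refine (Finset.sum_le_sum fun ω _ => Finset.sum_le_sum fun ω' _ => h1 ω ω').trans ?_
    refine (sum_exp_sign_le (ι := Fin d → Fin p) c).trans ?_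
    refine mul_le_mul_of_nonneg_right (Real.exp_le_exp.mpr ?_) (by positivity)
    have h4 : (Fintype.card (Fin d → Fin p) : ℝ) * c ^ 2 =
        ρ ^ 4 * ((v ^ d) ^ 2 * ((n : ℝ) ^ 2 * (a ^ 2 * S ^ d) * h ^ d)) := by
      rw [hc, hS, Fintype.card_pi_const, Fintype.card_fin]
      push_cast
      ring
    rw [h4]
    refine div_le_div_of_nonneg_right ?_ zero_le_two
    refine mul_le_mul_of_nonneg_left (le_trans ?_ hΛ) (by positivity)
    refine mul_le_of_le_one_left (by positivity) ?_
    exact pow_le_one₀ (by positivity) (pow_le_one₀ hφ2.le hv1)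
  have hmain := risk_lower_bound_of_mixture (Ω := (Fin d → Fin p) → Bool) N hf₀ hden hgm hg0 hg2
    (hδ0.trans_le hδ) (Real.exp_pos _) hnorm hmom (R := maxRisk N n F)
    (fun ω => le_iSup₂_of_le _ (hF ω) le_rfl)
  rcases hmain with hm | hm
  · left
    refine le_trans (ENNReal.ofReal_le_ofReal ?_) hm
    linarith
  · right
    refine (ENNReal.ofReal_le_ofReal ?_).trans (hm.trans (le_iSup₂_of_le _ hF' le_rfl))
    have h1 : √(Real.exp (ρ ^ 4 * Λ / 2)) = Real.exp (ρ ^ 4 * Λ / 4) := by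
      rw [Real.sqrt_eq_iff_mul_self_eq (Real.exp_pos _).le (Real.exp_pos _).le, ← Real.exp_add]
      congr 1
      ring
    rw [h1]
    gcongr

end Perturbation

/-! ### Densities that are constant on a cube -/

lemma rpow_invIndex_le_self {r : ℝ≥0∞} (hr : 1 ≤ r) {x : ℝ} (hx : 1 ≤ x) :
    x ^ invIndex r ≤ x := by
  simpa using Real.rpow_le_rpow_of_exponent_le hx (invIndex_le_one hr)

lemma smoothOfOrder_cellSum {d p k : ℕ} {φ : ℝ → ℝ}
    (hφ : ContDiff ℝ ((⊤ : ℕ∞) : WithTop ℕ∞) φ) {B a b : ℝ}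
    (hB : ∀ t, ∑ m : Fin p, |φ (t - (m : ℕ))| ≤ B)
    (hBk : ∀ t, ∑ m : Fin p, |iteratedDeriv k φ (t - (m : ℕ))| ≤ B)
    (hsupp : ∀ t, φ t ≠ 0 → t ∈ Set.Icc a b) {w : (Fin d → Fin p) → ℝ} (hw : ∀ m, |w m| ≤ 1)
    {h S A M β : ℝ} (hh : 0 < h) (hS : 0 < S) (hhS : (b + p - 1 - a) * h ≤ 3 * S) (hA : 0 ≤ A)
    {r : ℝ≥0∞} (hr : 1 ≤ r) (hβ : 0 < β) (hk : β < k) (hM : A * (S ^ d) ^ invIndex r ≤ M)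
    (hMh : A * (S ^ d) ^ invIndex r ≤ M * h ^ β) :
    SmoothOfOrder k β r (M * (B ^ d * ((1 + 2 ^ k) * (k + 1) * 3 ^ d)))
      (A • cellSum (fun _ => φ) h w) := by
  have hB0 : 0 ≤ B := (Finset.sum_nonneg fun _ _ => abs_nonneg _).trans (hB 0)
  have hSd : 0 < S ^ d := pow_pos hS d
  have hi := invIndex_nonneg r
  have h3 : ((3 * S) ^ d) ^ invIndex r ≤ 3 ^ d * (S ^ d) ^ invIndex r := by
    rw [mul_pow, Real.mul_rpow (by positivity) hSd.le]
    gcongr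
    exact rpow_invIndex_le_self hr (one_le_pow₀ (by norm_num))
  have hM0 : 0 ≤ M := le_trans (by positivity) hM
  refine smoothOfOrder_of_bounded (g := A • cellSum (fun _ => φ) h w) (A := A * B ^ d) (C := 1) (v := (3 * S) ^ d) (h := h)
    (B := Set.Icc (fun _ : Fin d => a * h) (fun _ => (b + p - 1) * h)) hr hβ hk
    ((continuous_cellSum (fun _ => hφ.continuous) h w).measurable.const_mul A) le_rfl hh
    (by positivity) measurableSet_Icc ?_ ?_ ?_ ?_ ?_ ?_
  · intro x
    rw [Pi.smul_apply, smul_eq_mul, abs_mul, abs_of_nonneg hA]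
    gcongr
    exact abs_cellSum_le (φ := fun _ => φ) (fun _ => hB) hw h x
  · intro x hx
    exact mem_of_cellSum_ne_zero hsupp hh (right_ne_zero_of_mul hx)
  · rw [Real.volume_Icc_pi, Finset.prod_const, Finset.card_univ, Fintype.card_fin,
      ENNReal.ofReal_pow (by positivity)]
    gcongr
    linarith
  · intro u j x
    rw [iterate_diffOp_smul, Pi.smul_apply, smul_eq_mul, abs_mul, abs_of_nonneg hA, mul_one,
      mul_assoc]
    gcongr
    exact abs_iterate_diffOp_cellSum_le hφ hB hBk hw hh u j x
  · calc A * B ^ d * ((3 * S) ^ d) ^ invIndex r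
        ≤ A * B ^ d * (3 ^ d * (S ^ d) ^ invIndex r) := by gcongr
      _ = (A * (S ^ d) ^ invIndex r) * (B ^ d * (1 * 3 ^ d)) := by ring
      _ ≤ M * (B ^ d * ((1 + 2 ^ k) * (k + 1) * 3 ^ d)) := by
        gcongr
        have h1 : (1 : ℝ) ≤ 1 + 2 ^ k := by linarith [pow_pos (two_pos (α := ℝ)) k]
        have h2 : (1 : ℝ) ≤ k + 1 := by linarith [(Nat.cast_nonneg k : (0 : ℝ) ≤ k)]
        nlinarith
  · have h4 : (((k : ℝ) + 1) * (3 * S) ^ d) ^ invIndex r ≤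
        (k + 1) * (3 ^ d * (S ^ d) ^ invIndex r) := by
      rw [Real.mul_rpow (by positivity) (by positivity)]
      gcongr
      exact rpow_invIndex_le_self hr (by linarith [(Nat.cast_nonneg k : (0 : ℝ) ≤ k)])
    calc A * B ^ d * (1 + 2 ^ k) * (((k : ℝ) + 1) * (3 * S) ^ d) ^ invIndex r
        ≤ A * B ^ d * (1 + 2 ^ k) * ((k + 1) * (3 ^ d * (S ^ d) ^ invIndex r)) := by gcongr
      _ = (A * (S ^ d) ^ invIndex r) * (B ^ d * ((1 + 2 ^ k) * (k + 1) * 3 ^ d)) := by ring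
      _ ≤ M * h ^ β * (B ^ d * ((1 + 2 ^ k) * (k + 1) * 3 ^ d)) := by gcongr
      _ = M * (B ^ d * ((1 + 2 ^ k) * (k + 1) * 3 ^ d)) * h ^ β := by ring

/-- A smooth density on the line, supported in `[-1, 2]` and equal to `c₀` on `[0, 1]`; the
constant `B` bounds it together with its derivative of order `k`. -/
structure IsFlatProfile (k : ℕ) (c₀ B : ℝ) (φ : ℝ → ℝ) : Prop where
  contDiff : ContDiff ℝ ((⊤ : ℕ∞) : WithTop ℕ∞) φ
  compact : HasCompactSupport φ
  nonneg : ∀ t, 0 ≤ φ t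
  integral_eq_one : ∫ t, φ t = 1
  support : ∀ t, φ t ≠ 0 → t ∈ Set.Icc (-1 : ℝ) 2
  pos : 0 < c₀
  flat : ∀ t ∈ Set.Icc (0 : ℝ) 1, φ t = c₀
  one_le : 1 ≤ B
  le : ∀ t, |φ t| ≤ B
  deriv_le : ∀ t, |iteratedDeriv k φ t| ≤ B

lemma exists_isFlatProfile (k : ℕ) : ∃ c₀ B φ, IsFlatProfile k c₀ B φ := by
  obtain ⟨φ, h1, h2, h3, h4, h5, c₀, h6, h7⟩ := exists_flat_density
  obtain ⟨B₀, hB₀⟩ := exists_bound_iteratedDeriv h1 h2 0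
  obtain ⟨B₁, hB₁⟩ := exists_bound_iteratedDeriv h1 h2 k
  refine ⟨c₀, max 1 (max B₀ B₁), φ, h1, h2, h3, h4, h5, h6, h7, le_max_left _ _, ?_, ?_⟩
  · intro t
    have := hB₀ t
    rw [iteratedDeriv_zero] at this
    exact this.trans ((le_max_left _ _).trans (le_max_right _ _))
  · exact fun t => (hB₁ t).trans ((le_max_right _ _).trans (le_max_right _ _))

/-- The product density with marginals `φ`, rescaled to the length `S`. -/
noncomputable def scaledDensity (d : ℕ) (φ : ℝ → ℝ) (S : ℝ) : (Fin d → ℝ) → ℝ :=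
  ((S ^ d)⁻¹ : ℝ) • cellSum (p := 1) (fun _ => φ) S fun _ => 1

namespace IsFlatProfile

variable {k : ℕ} {c₀ B : ℝ} {φ : ℝ → ℝ} (d : ℕ)

lemma scaledDensity_apply (S : ℝ) (x : Fin d → ℝ) :
    scaledDensity d φ S x = (S ^ d)⁻¹ * ∏ l, φ (x l / S) := by
  simp [scaledDensity, cellSum]

lemma measurable_scaledDensity (h : IsFlatProfile k c₀ B φ) (S : ℝ) :
    Measurable (scaledDensity d φ S) :=
  (continuous_cellSum (fun _ => h.contDiff.continuous) S _).measurable.const_mul _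

lemma scaledDensity_nonneg (h : IsFlatProfile k c₀ B φ) {S : ℝ} (hS : 0 < S) (x : Fin d → ℝ) :
    0 ≤ scaledDensity d φ S x := by
  rw [scaledDensity_apply]
  exact mul_nonneg (by positivity) (Finset.prod_nonneg fun _ _ => h.nonneg _)

lemma isDensity_scaledDensity (h : IsFlatProfile k c₀ B φ) {S : ℝ} (hS : 0 < S) :
    IsDensity (scaledDensity d φ S) := by
  have hi : Integrable φ := h.contDiff.continuous.integrable_of_hasCompactSupport h.compact
  refine isDensity_of_integral_eq_one (measurable_scaledDensity d h S)
    (scaledDensity_nonneg d h hS) ((integrable_cellSum hi hS _).const_mul _) ?_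
  have h1 := integral_cellSum (d := d) (p := 1) hi hS fun _ => 1
  simp only [h.integral_eq_one, mul_one, Finset.sum_const, Finset.card_univ] at h1
  have h2 : ∫ x, scaledDensity d φ S x =
      (S ^ d)⁻¹ * ∫ x, cellSum (p := 1) (d := d) (fun _ => φ) S (fun _ => 1) x :=
    integral_const_mul _ _
  rw [h2, h1]
  have : S ^ d ≠ 0 := (pow_pos hS d).ne'
  simp [this]

lemma scaledDensity_le (h : IsFlatProfile k c₀ B φ) {S : ℝ} (hS : 0 < S) (x : Fin d → ℝ) :
    scaledDensity d φ S x ≤ (S ^ d)⁻¹ * B ^ d := by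
  rw [scaledDensity_apply]
  gcongr
  calc ∏ l, φ (x l / S) ≤ ∏ _l : Fin d, B :=
        Finset.prod_le_prod (fun _ _ => h.nonneg _) fun l _ => (le_abs_self _).trans (h.le _)
    _ = B ^ d := by simp

lemma scaledDensity_flat (h : IsFlatProfile k c₀ B φ) {S W : ℝ} (hS : 0 < S) (hSW : S ≤ W)
    {x : Fin d → ℝ} (hx : x ∈ Set.Icc (fun _ : Fin d => (0 : ℝ)) (fun _ => S)) :
    scaledDensity d φ W x = (W ^ d)⁻¹ * c₀ ^ d := by
  have hW : 0 < W := hS.trans_le hSW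
  rw [scaledDensity_apply]
  have h1 : ∀ l, φ (x l / W) = c₀ := fun l =>
    h.flat _ ⟨div_nonneg (hx.1 l) hW.le, (div_le_one hW).mpr ((hx.2 l).trans hSW)⟩
  simp [h1]

lemma integral_sq_scaledDensity_le (h : IsFlatProfile k c₀ B φ) {S : ℝ} (hS : 0 < S) :
    Integrable (fun x => scaledDensity d φ S x ^ 2) ∧
    ∫ x, scaledDensity d φ S x ^ 2 ≤ (S ^ d)⁻¹ * B ^ d := by
  have hD := isDensity_scaledDensity d h hS
  have hle : ∀ x, scaledDensity d φ S x ^ 2 ≤ (S ^ d)⁻¹ * B ^ d * scaledDensity d φ S x := by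
    intro x
    rw [sq]
    exact mul_le_mul_of_nonneg_right (scaledDensity_le d h hS x) (scaledDensity_nonneg d h hS x)
  have hi : Integrable fun x => scaledDensity d φ S x ^ 2 := by
    refine (hD.integrable.const_mul ((S ^ d)⁻¹ * B ^ d)).mono'
      (hD.measurable.pow_const 2).aestronglyMeasurable (Eventually.of_forall fun x => ?_)
    rw [Real.norm_of_nonneg (sq_nonneg _)]
    exact hle x
  refine ⟨hi, (integral_mono hi (hD.integrable.const_mul _) hle).trans (le_of_eq ?_)⟩
  rw [integral_const_mul, hD.integral_eq_one, mul_one]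

/-- The multiple of amplitude `A` of a scaled density is smooth as soon as its norm is bounded
and the amplitude is compatible with oscillations at scale `S`. -/
lemma smoothOfOrder_smul_scaledDensity (h : IsFlatProfile k c₀ B φ) {S α A M β : ℝ} (hS : 0 < S)
    (hA : 0 ≤ A) (hα : α * (S ^ d)⁻¹ = A) {r : ℝ≥0∞} (hr : 1 ≤ r) (hβ : 0 < β) (hk : β < k)
    (hM : A * (S ^ d) ^ invIndex r ≤ M) (hMS : A * (S ^ d) ^ invIndex r ≤ M * S ^ β) :
    SmoothOfOrder k β r (M * (B ^ d * ((1 + 2 ^ k) * (k + 1) * 3 ^ d)))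
      (α • scaledDensity d φ S) := by
  rw [scaledDensity, smul_smul, hα]
  refine smoothOfOrder_cellSum (a := -1) (b := 2) h.contDiff (fun t => ?_) (fun t => ?_) h.support
    (fun _ => by simp) hS hS ?_ hA hr hβ hk hM hMS
  · simpa using h.le t
  · simpa using h.deriv_le t
  · push_cast
    linarith

end IsFlatProfile

/-- A bounded density of `L₂`-norm of order `A * S ^ (d / 2)` that is constant, of order `A`, on a
cube of side `S`, and that belongs to the Nikolskii classes with parameters satisfying `P`, with
differences of order `k`. The constants `c` and `K` do not depend on `S` and `A`. -/
structure IsFlatDensity {d : ℕ} (k : ℕ) (c K S A : ℝ) (P : ℝ → ℝ≥0∞ → Prop)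
    (f : (Fin d → ℝ) → ℝ) (a : ℝ) : Prop where
  density : IsDensity f
  flat : ∀ x ∈ Set.Icc (fun _ : Fin d => (0 : ℝ)) (fun _ => S), f x = a
  le_amp : c * A ≤ a
  amp_le : a ≤ 2 * c * A
  le : ∀ x, f x ≤ K
  integrable_sq : Integrable fun x => f x ^ 2
  integral_sq_le : ∫ x, f x ^ 2 ≤ K * (A ^ 2 * S ^ d)
  smooth : ∀ (β : ℝ) (r : ℝ≥0∞), 0 < β → β < k → 1 ≤ r → P β r → SmoothOfOrder k β r K f

/-- The spread out densities: mass one on a cube of side `S ≥ 1`. -/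
lemma exists_isFlatDensity_spread (d k : ℕ) : ∃ c K : ℝ, 0 < c ∧ 0 < K ∧ ∀ S : ℝ, 1 ≤ S →
    ∃ (f : (Fin d → ℝ) → ℝ) (a : ℝ),
      IsFlatDensity k c K S (S ^ d)⁻¹ (fun _ _ => True) f a := by
  obtain ⟨c₀, B, φ, h⟩ := exists_isFlatProfile k
  have hc := h.pos
  have hB : 0 < B := one_pos.trans_le h.one_le
  have hC : (1 : ℝ) ≤ (1 + 2 ^ k) * (k + 1) * 3 ^ d := by
    have h1 : (1 : ℝ) ≤ 1 + 2 ^ k := by linarith [pow_pos (two_pos (α := ℝ)) k]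
    have h2 : (1 : ℝ) ≤ k + 1 := by linarith [(Nat.cast_nonneg k : (0 : ℝ) ≤ k)]
    exact one_le_mul_of_one_le_of_one_le (one_le_mul_of_one_le_of_one_le h1 h2)
      (one_le_pow₀ (by norm_num))
  have hK : B ^ d ≤ B ^ d * ((1 + 2 ^ k) * (k + 1) * 3 ^ d) :=
    le_mul_of_one_le_right (by positivity) hC
  refine ⟨c₀ ^ d, B ^ d * ((1 + 2 ^ k) * (k + 1) * 3 ^ d), by positivity, by positivity,
    fun S hS => ⟨scaledDensity d φ S, c₀ ^ d * (S ^ d)⁻¹, ?_⟩⟩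
  have hS0 : 0 < S := one_pos.trans_le hS
  have hSd : 1 ≤ S ^ d := one_le_pow₀ hS
  have hSd0 : 0 < S ^ d := pow_pos hS0 d
  have hAle : (S ^ d)⁻¹ ≤ 1 := inv_le_one_of_one_le₀ hSd
  refine ⟨h.isDensity_scaledDensity d hS0, fun x hx => ?_, le_rfl, ?_, fun x => ?_,
    (h.integral_sq_scaledDensity_le d hS0).1, ?_, fun β r hβ hk hr _ => ?_⟩
  · rw [h.scaledDensity_flat d hS0 le_rfl hx, mul_comm]
  · have : 0 < c₀ ^ d * (S ^ d)⁻¹ := by positivity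
    linarith
  · refine (h.scaledDensity_le d hS0 x).trans (le_trans ?_ hK)
    exact mul_le_of_le_one_left (by positivity) hAle
  · refine (h.integral_sq_scaledDensity_le d hS0).2.trans ?_
    have h1 : ((S ^ d)⁻¹) ^ 2 * S ^ d = (S ^ d)⁻¹ := by field_simp
    rw [h1, mul_comm]
    gcongr
  · have h1 : (S ^ d)⁻¹ * (S ^ d) ^ invIndex r ≤ 1 := by
      rw [inv_mul_le_one₀ hSd0]
      exact rpow_invIndex_le_self hr hSd
    have := h.smoothOfOrder_smul_scaledDensity d (α := 1) (M := 1) hS0 (by positivity) (one_mul _)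
      hr hβ hk h1 (by rw [one_mul]; exact h1.trans (Real.one_le_rpow hS hβ.le))
    simpa using this

/-- The concentrated densities: amplitude of order one on a cube of side `S ≤ 1`, the remaining
mass being spread over a cube of side `S⁻¹`. -/
lemma exists_isFlatDensity_concentrated (d k : ℕ) : ∃ c K : ℝ, 0 < c ∧ 0 < K ∧
    ∀ S : ℝ, 0 < S → S ≤ 1 → ∃ (f : (Fin d → ℝ) → ℝ) (a : ℝ),
      IsFlatDensity k c K S 1 (fun β r => β ≤ d * invIndex r) f a := by
  obtain ⟨c₀, B, φ, h⟩ := exists_isFlatProfile k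
  have hc := h.pos
  have hB : 0 < B := one_pos.trans_le h.one_le
  have hC : (1 : ℝ) ≤ (1 + 2 ^ k) * (k + 1) * 3 ^ d := by
    have h1 : (1 : ℝ) ≤ 1 + 2 ^ k := by linarith [pow_pos (two_pos (α := ℝ)) k]
    have h2 : (1 : ℝ) ≤ k + 1 := by linarith [(Nat.cast_nonneg k : (0 : ℝ) ≤ k)]
    exact one_le_mul_of_one_le_of_one_le (one_le_mul_of_one_le_of_one_le h1 h2)
      (one_le_pow₀ (by norm_num))
  have hK : B ^ d ≤ B ^ d * ((1 + 2 ^ k) * (k + 1) * 3 ^ d) :=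
    le_mul_of_one_le_right (by positivity) hC
  set K₀ : ℝ := B ^ d * ((1 + 2 ^ k) * (k + 1) * 3 ^ d) with hK₀
  have hK₀0 : 0 < K₀ := by positivity
  refine ⟨c₀ ^ d, 4 * K₀, by positivity, by positivity, fun S hS0 hS1 => ?_⟩
  have hSd0 : 0 < S ^ d := pow_pos hS0 d
  have hSd1 : S ^ d ≤ 1 := pow_le_one₀ hS0.le hS1
  have hW1 : 1 ≤ S⁻¹ := (one_le_inv₀ hS0).mpr hS1
  have hW0 : 0 < S⁻¹ := inv_pos.mpr hS0
  have hWd : (S⁻¹ ^ d)⁻¹ = S ^ d := by rw [inv_pow, inv_inv]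
  set α : ℝ := S ^ d with hα
  have hα' : 0 ≤ 1 - α := by linarith
  set u := α • scaledDensity d φ S with hu
  set v := (1 - α) • scaledDensity d φ S⁻¹ with hv
  have hu0 : ∀ x, 0 ≤ u x := fun x => mul_nonneg hSd0.le (h.scaledDensity_nonneg d hS0 x)
  have hv0 : ∀ x, 0 ≤ v x := fun x => mul_nonneg hα' (h.scaledDensity_nonneg d hW0 x)
  have hule : ∀ x, u x ≤ B ^ d := by
    intro x
    have := mul_le_mul_of_nonneg_left (h.scaledDensity_le d hS0 x) hSd0.le
    rwa [← mul_assoc, mul_inv_cancel₀ hSd0.ne', one_mul] at this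
  have hvle : ∀ x, v x ≤ B ^ d := by
    intro x
    have h1 := h.scaledDensity_le d hW0 x
    rw [hWd] at h1
    calc v x = (1 - α) * scaledDensity d φ S⁻¹ x := rfl
      _ ≤ 1 * (1 * B ^ d) := by
        gcongr
        · exact h.scaledDensity_nonneg d hW0 x
        · linarith
        · exact h1.trans (by gcongr)
      _ = B ^ d := by ring
  have hum : Measurable u := (h.measurable_scaledDensity d S).const_mul _
  have hvm : Measurable v := (h.measurable_scaledDensity d S⁻¹).const_mul _
  have hui : Integrable u := (h.isDensity_scaledDensity d hS0).integrable.const_mul _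
  have hvi : Integrable v := (h.isDensity_scaledDensity d hW0).integrable.const_mul _
  have hsq := h.integral_sq_scaledDensity_le d hS0
  have hsq' := h.integral_sq_scaledDensity_le d hW0
  have hui2 : Integrable fun x => u x ^ 2 := by
    have : (fun x => u x ^ 2) = fun x => α ^ 2 * scaledDensity d φ S x ^ 2 := by
      ext x
      simp only [hu, Pi.smul_apply, smul_eq_mul, mul_pow]
    rw [this]
    exact hsq.1.const_mul _
  have hvi2 : Integrable fun x => v x ^ 2 := by
    have : (fun x => v x ^ 2) = fun x => (1 - α) ^ 2 * scaledDensity d φ S⁻¹ x ^ 2 := by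
      ext x
      simp only [hv, Pi.smul_apply, smul_eq_mul, mul_pow]
    rw [this]
    exact hsq'.1.const_mul _
  have hu2 : ∫ x, u x ^ 2 ≤ α * B ^ d := by
    calc ∫ x, u x ^ 2 = ∫ x, α ^ 2 * scaledDensity d φ S x ^ 2 := by
          refine integral_congr_ae (Eventually.of_forall fun x => ?_)
          simp only [hu, Pi.smul_apply, smul_eq_mul, mul_pow]
      _ = α ^ 2 * ∫ x, scaledDensity d φ S x ^ 2 := integral_const_mul _ _
      _ ≤ α ^ 2 * (α⁻¹ * B ^ d) := by gcongr; exact hsq.2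
      _ = α * B ^ d := by field_simp
  have hv2 : ∫ x, v x ^ 2 ≤ α * B ^ d := by
    calc ∫ x, v x ^ 2 = ∫ x, (1 - α) ^ 2 * scaledDensity d φ S⁻¹ x ^ 2 := by
          refine integral_congr_ae (Eventually.of_forall fun x => ?_)
          simp only [hv, Pi.smul_apply, smul_eq_mul, mul_pow]
      _ = (1 - α) ^ 2 * ∫ x, scaledDensity d φ S⁻¹ x ^ 2 := integral_const_mul _ _
      _ ≤ 1 * (α * B ^ d) := by
        have h1 := hsq'.2
        rw [hWd] at h1
        exact mul_le_mul (pow_le_one₀ hα' (by linarith)) h1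
          (integral_nonneg fun x => sq_nonneg (scaledDensity d φ S⁻¹ x)) zero_le_one
      _ = α * B ^ d := one_mul _
  have hle2 : ∀ x, (u + v) x ^ 2 ≤ 2 * u x ^ 2 + 2 * v x ^ 2 := fun x => by
    simp only [Pi.add_apply]
    nlinarith [sq_nonneg (u x - v x)]
  have hi2 : Integrable fun x => 2 * u x ^ 2 + 2 * v x ^ 2 :=
    (hui2.const_mul 2).add (hvi2.const_mul 2)
  have huvi2 : Integrable fun x => (u + v) x ^ 2 := by
    refine hi2.mono' ((hum.add hvm).pow_const 2).aestronglyMeasurable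
      (Eventually.of_forall fun x => ?_)
    rw [Real.norm_of_nonneg (sq_nonneg _)]
    exact hle2 x
  refine ⟨u + v, c₀ ^ d * (1 + (1 - α) * α), ?_, fun x hx => ?_, ?_, ?_, fun x => ?_, huvi2, ?_,
    fun β r hβ hk hr hP => ?_⟩
  · refine isDensity_of_integral_eq_one (hum.add hvm) (fun x => add_nonneg (hu0 x) (hv0 x))
      (hui.add hvi) ?_
    have h1 : ∫ x, u x = α := by
      calc ∫ x, u x = α * ∫ x, scaledDensity d φ S x := integral_const_mul _ _
        _ = α := by rw [(h.isDensity_scaledDensity d hS0).integral_eq_one, mul_one]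
    have h2 : ∫ x, v x = 1 - α := by
      calc ∫ x, v x = (1 - α) * ∫ x, scaledDensity d φ S⁻¹ x := integral_const_mul _ _
        _ = 1 - α := by rw [(h.isDensity_scaledDensity d hW0).integral_eq_one, mul_one]
    rw [integral_add' hui hvi, h1, h2]
    ring
  · simp only [Pi.add_apply, hu, hv, Pi.smul_apply, smul_eq_mul]
    rw [h.scaledDensity_flat d hS0 le_rfl hx, h.scaledDensity_flat d hS0 (hS1.trans hW1) hx, hWd,
      ← hα, ← mul_assoc α, mul_inv_cancel₀ hSd0.ne']
    ring
  · rw [mul_one]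
    exact le_mul_of_one_le_right (by positivity) (by linarith [mul_nonneg hα' hSd0.le])
  · rw [mul_one, mul_comm 2]
    gcongr
    nlinarith
  · have h1 := hule x
    have h2 := hvle x
    simp only [Pi.add_apply]
    linarith
  · calc ∫ x, (u + v) x ^ 2 ≤ ∫ x, (2 * u x ^ 2 + 2 * v x ^ 2) := integral_mono huvi2 hi2 hle2
      _ = 2 * (∫ x, u x ^ 2) + 2 * ∫ x, v x ^ 2 := by
        rw [integral_add (hui2.const_mul 2) (hvi2.const_mul 2), integral_const_mul,
          integral_const_mul]
      _ ≤ 4 * (α * B ^ d) := by linarith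
      _ ≤ 4 * (α * K₀) := by gcongr
      _ = 4 * K₀ * (1 ^ 2 * α) := by ring
  · have hiu : α * (S ^ d)⁻¹ = 1 := mul_inv_cancel₀ hSd0.ne'
    have hu1 : 1 * (S ^ d) ^ invIndex r ≤ 1 := by
      rw [one_mul]
      exact Real.rpow_le_one hSd0.le hSd1 (invIndex_nonneg r)
    have hu3 : 1 * (S ^ d) ^ invIndex r ≤ 1 * S ^ β := by
      rw [one_mul, one_mul, ← Real.rpow_natCast, ← Real.rpow_mul hS0.le]
      exact Real.rpow_le_rpow_of_exponent_ge hS0 hS1 hP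
    have hsu := h.smoothOfOrder_smul_scaledDensity d hS0 zero_le_one hiu hr hβ hk hu1 hu3
    have hWd1 : 1 ≤ S⁻¹ ^ d := one_le_pow₀ hW1
    have hv1 : (1 - α) * (S⁻¹ ^ d)⁻¹ * (S⁻¹ ^ d) ^ invIndex r ≤ 1 := by
      calc (1 - α) * (S⁻¹ ^ d)⁻¹ * (S⁻¹ ^ d) ^ invIndex r
          ≤ 1 * (S⁻¹ ^ d)⁻¹ * (S⁻¹ ^ d) := by
            gcongr
            · linarith
            · exact rpow_invIndex_le_self hr hWd1
        _ = 1 := by rw [one_mul, inv_mul_cancel₀ (by positivity)]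
    have hsv := h.smoothOfOrder_smul_scaledDensity d (M := 1) hW0 (by positivity) rfl hr hβ hk hv1
      (by rw [one_mul]; exact hv1.trans (Real.one_le_rpow hW1 hβ.le))
    rw [one_mul] at hsu hsv
    exact (hsu.add hr hK₀0.le hK₀0.le hsv).mono (by linarith)

/-! ### Lower bounds for the maximal risks over two classes -/

lemma mem_boundedClass {d k : ℕ} {β L Q : ℝ} {r : ℝ≥0∞} {f : (Fin d → ℝ) → ℝ} (hf : IsDensity f)
    (hs : SmoothOfOrder k β r L f) (hk : β < k) (hQ : ∀ x, f x ≤ Q) :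
    f ∈ boundedClass d (β, r) L Q := by
  refine ⟨hf, hs.mem_nikolskii hk, ?_⟩
  rw [normLp, if_pos rfl]
  refine iSup_le fun x => ENNReal.ofReal_le_ofReal ?_
  rw [abs_of_nonneg (hf.nonneg x)]
  exact hQ x

/-- The lower bound produced by a flat density of amplitude `A` on a cube of side `S`, perturbed on
cells of side of order `η`. The number `ψ` is the order of its norm. -/
theorem maxRisk_lower_bound_of_isFlatDensity {d k : ℕ} (hd : d ≠ 0) {c K : ℝ} (hc : 0 < c)
    (hK : 0 < K) {P : ℝ → ℝ≥0∞ → Prop} {β : ℝ} {r : ℝ≥0∞} (hβ : 0 < β) (hk : β < k) (hr : 1 ≤ r)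
    (hP : P β r) :
    ∃ κ T L : ℝ, 0 < κ ∧ 0 < T ∧ 0 < L ∧ ∀ (β' : ℝ) (r' : ℝ≥0∞), 0 < β' → β' < k → 1 ≤ r' →
      P β' r' → ∀ (N : Estimator d) (n : ℕ) (S A ψ η a ρ Λ : ℝ) (f : (Fin d → ℝ) → ℝ),
      0 < S → 0 < A → 0 < ψ → 0 < η → 0 < ρ → ρ ≤ 1 → IsFlatDensity k c K S A P f a →
      A ^ 2 * S ^ d = ψ ^ 2 → η ≤ S → A * (S ^ d) ^ invIndex r ≤ 1 →
      A * (S ^ d) ^ invIndex r ≤ η ^ β → (n : ℝ) ^ 2 * ψ ^ 2 * η ^ d ≤ Λ →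
      ENNReal.ofReal (κ * ρ ^ 2 * ψ) ≤ maxRisk N n (boundedClass d (β, r) L L) ∨
      ENNReal.ofReal (κ * ρ ^ 2 * ψ / Real.exp (T * ρ ^ 4 * Λ)) ≤
        maxRisk N n (boundedClass d (β', r') L L) := by
  obtain ⟨φ, hφ, hφc, hφi, hφ1, hφd, hφ2⟩ := exists_oscillating_profile
  have hφ0 : ∀ t, φ t ≠ 0 → t ∈ Set.Ioo (0 : ℝ) 1 := fun t ht => hφd 0 t (by simpa using ht)
  obtain ⟨B₀, hB₀⟩ := exists_bound_iteratedDeriv hφ hφc k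
  set B : ℝ := max 1 B₀ with hB
  have hB0 : 0 < B := one_pos.trans_le (le_max_left _ _)
  set v : ℝ := ∫ t, φ t ^ 2 with hv
  set D : ℝ := √K / c with hD
  have hD0 : 0 ≤ D := by positivity
  set C : ℝ := 2 * c * (B ^ d * ((1 + 2 ^ k) * (k + 1) * 3 ^ d)) with hC
  have hC0 : 0 < C := by positivity
  refine ⟨v ^ d / (2 * D + 1) * c / 4, c ^ 2 * 2 ^ d, 2 * K + C, by positivity, by positivity,
    by positivity, ?_⟩
  intro β' r' hβ' hk' hr' hP' N n S A ψ η a ρ Λ f hS hA hψ hη hρ0 hρ1 hf hAS hηS hA1 hAη hΛ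
  have hcA : 0 < c * A := by positivity
  have ha : 0 < a := hcA.trans_le hf.le_amp
  have hSd : 0 < S ^ d := pow_pos hS d
  -- the number of cells in each direction
  set p : ℕ := ⌊S / η⌋₊ with hp
  have hp1 : 1 ≤ p := by
    rw [hp, Nat.one_le_floor_iff, one_le_div hη]
    exact hηS
  have hp0 : (0 : ℝ) < p := by exact_mod_cast hp1
  set h : ℝ := S / p with hh
  have hh0 : 0 < h := by positivity
  have hηh : η ≤ h := by
    rw [hh, le_div_iff₀ hp0, mul_comm, ← le_div_iff₀ hη]
    exact Nat.floor_le (by positivity)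
  have hhη : h ≤ 2 * η := by
    have h1 : S / η < p + 1 := Nat.lt_floor_add_one _
    have h2 : (1 : ℝ) ≤ p := by exact_mod_cast hp1
    rw [hh, div_le_iff₀ hp0]
    rw [div_lt_iff₀ hη] at h1
    nlinarith
  have hSp : S = p * h := by rw [hh]; field_simp
  have hamp : c * ψ ≤ √(a ^ 2 * S ^ d) := by
    refine Real.le_sqrt_of_sq_le ?_
    calc (c * ψ) ^ 2 = (c * A) ^ 2 * S ^ d := by rw [mul_pow, ← hAS]; ring
      _ ≤ a ^ 2 * S ^ d := by
        have := hf.le_amp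
        gcongr
  have hsq : ∫ x, f x ^ 2 ≤ D ^ 2 * (a ^ 2 * S ^ d) := by
    refine hf.integral_sq_le.trans ?_
    calc K * (A ^ 2 * S ^ d) = D ^ 2 * ((c * A) ^ 2 * S ^ d) := by
          rw [hD, div_pow, Real.sq_sqrt hK.le]
          field_simp
      _ ≤ _ := by
        have := hf.le_amp
        gcongr
  have hΛ' : (n : ℝ) ^ 2 * (a ^ 2 * S ^ d) * h ^ d ≤ 4 * c ^ 2 * 2 ^ d * Λ := by
    calc (n : ℝ) ^ 2 * (a ^ 2 * S ^ d) * h ^ d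
        ≤ (n : ℝ) ^ 2 * ((2 * c * A) ^ 2 * S ^ d) * (2 * η) ^ d := by
          have := hf.amp_le
          gcongr
      _ = 4 * c ^ 2 * 2 ^ d * ((n : ℝ) ^ 2 * ψ ^ 2 * η ^ d) := by
          rw [← hAS, mul_pow 2 η]
          ring
      _ ≤ _ := by gcongr
  have hfs : SmoothOfOrder k β r K f := hf.smooth β r hβ hk hr hP
  have hF' : f ∈ boundedClass d (β', r') (2 * K + C) (2 * K + C) :=
    mem_boundedClass hf.density ((hf.smooth β' r' hβ' hk' hr' hP').mono (by linarith)) hk'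
      fun x => (hf.le x).trans (by linarith)
  have hF : ∀ ω : (Fin d → Fin p) → Bool, (fun x => f x * perturbation φ h ρ ω x) ∈
      boundedClass d (β, r) (2 * K + C) (2 * K + C) := by
    intro ω
    have hgb := abs_perturbation_sub_one_le hφ1 hφ0 hρ0.le hρ1 h ω
    have hi : Integrable φ := hφ.continuous.integrable_of_hasCompactSupport hφc
    have hexp : (fun x => f x * perturbation φ h ρ ω x) =
        f + (ρ * a) • cellSum (fun _ => φ) h fun m => sign (ω m) := by
      ext x
      have h1 := mul_cellSum_of_flat hφ0 hh0 hSp hf.flat (fun m => sign (ω m)) x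
      simp only [perturbation, Pi.add_apply, Pi.smul_apply, smul_eq_mul]
      linear_combination ρ * h1
    have hρa : ρ * a ≤ 2 * c * A := by
      calc ρ * a ≤ 1 * a := by gcongr
        _ ≤ _ := by rw [one_mul]; exact hf.amp_le
    have hM : ρ * a * (S ^ d) ^ invIndex r ≤ 2 * c := by
      calc ρ * a * (S ^ d) ^ invIndex r ≤ 2 * c * A * (S ^ d) ^ invIndex r := by gcongr
        _ = 2 * c * (A * (S ^ d) ^ invIndex r) := by ring
        _ ≤ 2 * c * 1 := by gcongr
        _ = 2 * c := mul_one _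
    have hMh : ρ * a * (S ^ d) ^ invIndex r ≤ 2 * c * h ^ β := by
      calc ρ * a * (S ^ d) ^ invIndex r ≤ 2 * c * A * (S ^ d) ^ invIndex r := by gcongr
        _ = 2 * c * (A * (S ^ d) ^ invIndex r) := by ring
        _ ≤ 2 * c * h ^ β := by
          gcongr
          exact hAη.trans (Real.rpow_le_rpow hη.le hηh hβ.le)
    have hsm := smoothOfOrder_cellSum (d := d) (p := p) (k := k) (a := 0) (b := 1) hφ
      (sum_shift_le (fun t => (hφ1 t).trans (le_max_left 1 B₀)) hφ0)
      (sum_shift_le (fun t => (hB₀ t).trans (le_max_right 1 B₀)) (hφd k))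
      (fun t ht => Set.Ioo_subset_Icc_self (hφ0 t ht)) (w := fun m => sign (ω m))
      (fun m => (abs_sign _).le) hh0 hS (by rw [hSp]; nlinarith) (by positivity) hr hβ hk hM hMh
    have hnn : ∀ x, 0 ≤ f x * perturbation φ h ρ ω x := fun x =>
      mul_nonneg (hf.density.nonneg x) (by linarith [(abs_le.mp (hgb x)).1])
    have hden : IsDensity fun x => f x * perturbation φ h ρ ω x := by
      have hcell : Integrable ((ρ * a) • cellSum (fun _ => φ) h fun m => sign (ω m)) :=
        (integrable_cellSum hi hh0 _).const_mul _
      refine isDensity_of_integral_eq_one ?_ hnn ?_ ?_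
      · rw [hexp]
        exact hf.density.measurable.add hsm.measurable
      · rw [hexp]
        exact hf.density.integrable.add hcell
      · rw [hexp, integral_add' hf.density.integrable hcell, hf.density.integral_eq_one]
        have h1 : ∫ x, ((ρ * a) • cellSum (fun _ => φ) h fun m => sign (ω m)) x =
            ρ * a * ∫ x, cellSum (fun _ => φ) h (fun m => sign (ω m)) x := integral_const_mul _ _
        rw [h1, integral_cellSum hi hh0, hφi, mul_zero, zero_pow hd]
        simp
    refine mem_boundedClass (k := k) hden ?_ hk fun x => ?_
    · rw [hexp]
      refine (hfs.add hr hK.le ?_ hsm).mono ?_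
      · positivity
      · rw [hC]
        linarith
    · have h1 := (abs_le.mp (hgb x)).2
      calc f x * perturbation φ h ρ ω x ≤ K * 2 :=
            mul_le_mul (hf.le x) (by linarith) (by linarith [(abs_le.mp (hgb x)).1]) hK.le
        _ ≤ 2 * K + C := by linarith
  have hmain := maxRisk_lower_bound_of_flat hφ.continuous hφc hφi hd hφ1 hφ0 hφ2 hh0
    (Nat.one_le_iff_ne_zero.mp hp1) hSp ha hρ0 hρ1 hD0 hf.density hf.integrable_sq hf.flat hsq N
    hΛ' hF' hF
  have hδ : v ^ d / (2 * D + 1) * c * ρ ^ 2 * ψ ≤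
      ρ ^ 2 * v ^ d / (2 * D + 1) * √(a ^ 2 * S ^ d) := by
    calc v ^ d / (2 * D + 1) * c * ρ ^ 2 * ψ = ρ ^ 2 * v ^ d / (2 * D + 1) * (c * ψ) := by ring
      _ ≤ _ := by gcongr
  rcases hmain with hm | hm
  · left
    refine (ENNReal.ofReal_le_ofReal ?_).trans hm
    linarith
  · right
    refine (ENNReal.ofReal_le_ofReal ?_).trans hm
    have h1 : ρ ^ 4 * (4 * c ^ 2 * 2 ^ d * Λ) / 4 = c ^ 2 * 2 ^ d * ρ ^ 4 * Λ := by ring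
    rw [h1]
    have hE := Real.exp_pos (c ^ 2 * 2 ^ d * ρ ^ 4 * Λ)
    rw [div_le_div_iff₀ hE (by positivity)]
    have h2 : 0 ≤ v ^ d / (2 * D + 1) * c * ρ ^ 2 * ψ := by positivity
    calc v ^ d / (2 * D + 1) * c / 4 * ρ ^ 2 * ψ *
          (3 * Real.exp (c ^ 2 * 2 ^ d * ρ ^ 4 * Λ))
        = 3 / 4 * (v ^ d / (2 * D + 1) * c * ρ ^ 2 * ψ) *
          Real.exp (c ^ 2 * 2 ^ d * ρ ^ 4 * Λ) := by ring
      _ ≤ _ := mul_le_mul_of_nonneg_right (by linarith) hE.le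

/-! ### Asymptotics of the lower bounds -/

/-- The base `√(ln n) / n` of the normalizations. -/
noncomputable def rateBase (n : ℕ) : ℝ := √(Real.log n) / n

lemma psiStar_eq (d n : ℕ) (θ : RateParam) : psiStar d n θ = rateBase n ^ rateExponent d θ := rfl

lemma rateBase_pos {n : ℕ} (hn : 2 ≤ n) : 0 < rateBase n := by
  have h1 : (1 : ℝ) < n := by exact_mod_cast hn
  have := Real.log_pos h1
  unfold rateBase
  positivity

lemma rateBase_sq {n : ℕ} (hn : 2 ≤ n) : (n : ℝ) ^ 2 * rateBase n ^ 2 = Real.log n := by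
  have h1 : (1 : ℝ) < n := by exact_mod_cast hn
  rw [rateBase, div_pow, Real.sq_sqrt (Real.log_pos h1).le]
  field_simp

lemma rateBase_le {n : ℕ} (hn : 2 ≤ n) : rateBase n ≤ (n : ℝ) ^ (-(1 / 2) : ℝ) := by
  have h0 : (0 : ℝ) < n := by exact_mod_cast (by omega : 0 < n)
  have h1 : √(Real.log n) ≤ (n : ℝ) ^ (1 / 2 : ℝ) := by
    rw [← Real.sqrt_eq_rpow]
    exact Real.sqrt_le_sqrt ((Real.log_le_sub_one_of_pos h0).trans (by linarith))
  rw [rateBase, div_le_iff₀ h0]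
  refine h1.trans (le_of_eq ?_)
  nth_rewrite 3 [← Real.rpow_one (n : ℝ)]
  rw [← Real.rpow_add h0]
  norm_num

lemma rateBase_le_one {n : ℕ} (hn : 2 ≤ n) : rateBase n ≤ 1 := by
  refine (rateBase_le hn).trans (Real.rpow_le_one_of_one_le_of_nonpos ?_ (by norm_num))
  exact_mod_cast (by omega : 1 ≤ n)

/-- The scale of the cells matches the rate: `ψ ^ 2 * η ^ d` is the square of the base. -/
lemma rpow_scale {X β e ψ η : ℝ} {d : ℕ} (hX : 0 < X) (hβ : 0 < β) (he : 0 ≤ e)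
    (hψ : ψ = X ^ (β / (β + d * e))) (hη : η = ψ ^ (2 * e / β)) : ψ ^ 2 * η ^ d = X ^ 2 := by
  have hψ0 : 0 < ψ := by rw [hψ]; positivity
  have hde : 0 < β + d * e := by positivity
  rw [hη, ← Real.rpow_natCast, ← Real.rpow_natCast (ψ ^ (2 * e / β)), ← Real.rpow_mul hψ0.le,
    ← Real.rpow_add hψ0, hψ, ← Real.rpow_mul hX.le, ← Real.rpow_natCast X]
  congr 1
  push_cast
  field_simp

/-- An estimator whose maximal risk over the class of `θ` is below a constant multiple of
`psiStar d n θ` has a maximal risk of at least `n ^ (-ε) * psiStar d n θ`, up to a constant, over the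
class of `θ'`. For `θ` in the second zone, `θ'` is restricted to the second zone as well: the density
used there has a peak of fixed height and vanishing width, and its Nikolskii norms stay bounded only
for `β' ≤ d / r'`. -/
theorem maxRisk_dichotomy {d : ℕ} (hd : 1 ≤ d) {b : ℝ≥0∞} {θ θ' : RateParam}
    (hθ : θ ∈ zone₁ d b ∧ θ' ∈ rateParams b ∨ θ ∈ zone₂ d b ∧ θ' ∈ zone₂ d b) {ε : ℝ}
    (hε : 0 < ε) :
    ∃ κ L : ℝ, 0 < κ ∧ 0 < L ∧ ∀ N : Estimator d, ∀ᶠ n : ℕ in atTop,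
      ENNReal.ofReal (κ * psiStar d n θ) ≤ maxRisk N n (boundedClass d θ L L) ∨
      ENNReal.ofReal (κ * (n : ℝ) ^ (-ε) * psiStar d n θ) ≤
        maxRisk N n (boundedClass d θ' L L) := by
  obtain ⟨β, r⟩ := θ
  obtain ⟨β', r'⟩ := θ'
  have hd0 : d ≠ 0 := by omega
  have hdR : (0 : ℝ) < d := by exact_mod_cast hd
  obtain ⟨k, hk⟩ := exists_nat_gt (max β β')
  have hk1 : β < k := (le_max_left _ _).trans_lt hk
  have hk2 : β' < k := (le_max_right _ _).trans_lt hk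
  -- the amplitude of the perturbation makes the loss at most `n ^ ε`
  have hfinish : ∀ κ T : ℝ, 0 < κ → 0 < T → ∃ ρ : ℝ, 0 < ρ ∧ ρ ≤ 1 ∧
      ∀ (n : ℕ) (ψ : ℝ), 2 ≤ n → 0 < ψ → κ * ρ ^ 2 * (n : ℝ) ^ (-ε) * ψ ≤
        κ * ρ ^ 2 * ψ / Real.exp (T * ρ ^ 4 * Real.log n) := by
    intro κ T hκ hT
    set ρ : ℝ := min 1 (ε / T) with hρ
    have hρ0 : 0 < ρ := lt_min one_pos (by positivity)
    have hρ1 : ρ ≤ 1 := min_le_left _ _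
    refine ⟨ρ, hρ0, hρ1, fun n ψ hn hψ => ?_⟩
    have hn0 : (0 : ℝ) < n := by exact_mod_cast (by omega : 0 < n)
    have hlog : 0 ≤ Real.log n := Real.log_nonneg (by exact_mod_cast (by omega : 1 ≤ n))
    have h1 : T * ρ ^ 4 ≤ ε := by
      have h2 : ρ ^ 4 ≤ ρ := pow_le_of_le_one hρ0.le hρ1 (by norm_num)
      have h3 : ρ ≤ ε / T := min_le_right _ _
      rw [le_div_iff₀ hT] at h3
      nlinarith
    rw [div_eq_mul_inv, ← Real.exp_neg]
    have h4 : (n : ℝ) ^ (-ε) ≤ Real.exp (-(T * ρ ^ 4 * Real.log n)) := by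
      rw [Real.rpow_def_of_pos hn0]
      refine Real.exp_le_exp.mpr ?_
      nlinarith
    calc κ * ρ ^ 2 * (n : ℝ) ^ (-ε) * ψ = κ * ρ ^ 2 * ψ * (n : ℝ) ^ (-ε) := by ring
      _ ≤ _ := by gcongr
  rcases hθ with ⟨⟨⟨hβ, -, hr⟩, hr2, hlt⟩, hβ', -, hr'⟩ |
    ⟨⟨⟨hβ, -, hr⟩, hr2, hlt⟩, ⟨hβ', -, hr'⟩, -, hlt'⟩
  · simp only at hβ hr hr2 hlt hβ' hr'
    obtain ⟨c, K, hc, hK, hflat⟩ := exists_isFlatDensity_spread d k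
    obtain ⟨κ, T, L, hκ, hT, hL, hmain⟩ := maxRisk_lower_bound_of_isFlatDensity hd0 hc hK
      (P := fun _ _ => True) hβ hk1 hr trivial
    obtain ⟨ρ, hρ0, hρ1, hρ⟩ := hfinish κ T hκ hT
    refine ⟨κ * ρ ^ 2, L, by positivity, hL, fun N => ?_⟩
    filter_upwards [eventually_ge_atTop 2] with n hn
    have hX := rateBase_pos hn
    have hX1 := rateBase_le_one hn
    have he : 0 ≤ 1 - invIndex r := by linarith [invIndex_le_one hr]
    set ψ : ℝ := psiStar d n (β, r) with hψ
    have hψ' : ψ = rateBase n ^ (β / (β + d * (1 - invIndex r))) := by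
      rw [hψ, psiStar_eq, rateExponent, if_pos hr2, if_pos hlt]
    have hψ0 : 0 < ψ := by rw [hψ']; positivity
    have hψ1 : ψ ≤ 1 := by
      rw [hψ']
      exact Real.rpow_le_one hX.le hX1 (by positivity)
    set S : ℝ := ψ ^ (-(2 / d) : ℝ) with hS
    have hS0 : 0 < S := by positivity
    have hS1 : 1 ≤ S := Real.one_le_rpow_of_pos_of_le_one_of_nonpos hψ0 hψ1
      (by rw [neg_nonpos]; positivity)
    have hSd : S ^ d = (ψ ^ 2)⁻¹ := by
      rw [hS, ← Real.rpow_natCast, ← Real.rpow_mul hψ0.le, ← Real.rpow_natCast ψ,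
        ← Real.rpow_neg hψ0.le]
      congr 1
      push_cast
      field_simp
    set η : ℝ := ψ ^ (2 * (1 - invIndex r) / β) with hη
    have hη1 : η ≤ 1 := Real.rpow_le_one hψ0.le hψ1 (by positivity)
    have hA : (S ^ d)⁻¹ * (S ^ d) ^ invIndex r = ψ ^ (2 * (1 - invIndex r)) := by
      rw [hSd, inv_inv, ← Real.rpow_natCast, ← Real.rpow_neg hψ0.le, ← Real.rpow_mul hψ0.le,
        ← Real.rpow_add hψ0]
      congr 1
      push_cast
      ring
    obtain ⟨f, a, hf⟩ := hflat S hS1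
    have := hmain β' r' hβ' hk2 hr' trivial N n S (S ^ d)⁻¹ ψ η a ρ (Real.log n) f hS0
      (by positivity) hψ0 (by positivity) hρ0 hρ1 hf
      (by rw [hSd, inv_inv]; field_simp) (hη1.trans hS1)
      (by rw [hA]; exact Real.rpow_le_one hψ0.le hψ1 (by positivity))
      (by
        rw [hA, hη, ← Real.rpow_mul hψ0.le]
        refine le_of_eq ?_
        congr 1
        field_simp)
      (by rw [mul_assoc, rpow_scale hX hβ he hψ' hη, rateBase_sq hn])
    exact this.imp id fun h => (ENNReal.ofReal_le_ofReal (hρ n ψ hn hψ0)).trans h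
  · simp only at hβ hr hr2 hlt hβ' hr' hlt'
    obtain ⟨c, K, hc, hK, hflat⟩ := exists_isFlatDensity_concentrated d k
    obtain ⟨κ, T, L, hκ, hT, hL, hmain⟩ := maxRisk_lower_bound_of_isFlatDensity hd0 hc hK
      (P := fun β r => β ≤ d * invIndex r) hβ hk1 hr hlt.le
    obtain ⟨ρ, hρ0, hρ1, hρ⟩ := hfinish κ T hκ hT
    refine ⟨κ * ρ ^ 2, L, by positivity, hL, fun N => ?_⟩
    filter_upwards [eventually_ge_atTop 2] with n hn
    have hX := rateBase_pos hn
    have hX1 := rateBase_le_one hn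
    have he : 0 ≤ invIndex r := invIndex_nonneg r
    set ψ : ℝ := psiStar d n (β, r) with hψ
    have hψ' : ψ = rateBase n ^ (β / (β + d * invIndex r)) := by
      rw [hψ, psiStar_eq, rateExponent, if_neg (not_le.mpr hr2), if_pos hlt]
    have hψ0 : 0 < ψ := by rw [hψ']; positivity
    have hψ1 : ψ ≤ 1 := by
      rw [hψ']
      exact Real.rpow_le_one hX.le hX1 (by positivity)
    set S : ℝ := ψ ^ (2 / d : ℝ) with hS
    have hS0 : 0 < S := by positivity
    have hS1 : S ≤ 1 := Real.rpow_le_one hψ0.le hψ1 (by positivity)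
    have hSd : S ^ d = ψ ^ 2 := by
      rw [hS, ← Real.rpow_natCast, ← Real.rpow_mul hψ0.le, ← Real.rpow_natCast ψ]
      congr 1
      push_cast
      field_simp
    set η : ℝ := ψ ^ (2 * invIndex r / β) with hη
    have hA : 1 * (S ^ d) ^ invIndex r = ψ ^ (2 * invIndex r) := by
      rw [hSd, one_mul, ← Real.rpow_natCast, ← Real.rpow_mul hψ0.le]
      congr 1
    obtain ⟨f, a, hf⟩ := hflat S hS0 hS1
    have := hmain β' r' hβ' hk2 hr' hlt'.le N n S 1 ψ η a ρ (Real.log n) f hS0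
      one_pos hψ0 (by positivity) hρ0 hρ1 hf
      (by rw [hSd, one_pow, one_mul])
      (by
        refine Real.rpow_le_rpow_of_exponent_ge hψ0 hψ1 ?_
        rw [div_le_div_iff₀ hdR hβ]
        linarith)
      (by rw [hA]; exact Real.rpow_le_one hψ0.le hψ1 (by positivity))
      (by
        rw [hA, hη, ← Real.rpow_mul hψ0.le]
        refine le_of_eq ?_
        congr 1
        field_simp)
      (by rw [mul_assoc, rpow_scale hX hβ he hψ' hη, rateBase_sq hn])
    exact this.imp id fun h => (ENNReal.ofReal_le_ofReal (hρ n ψ hn hψ0)).trans h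

/-! ### Consequences for admissible normalizations -/

lemma IsAdmissible.exists_le {d : ℕ} {Θ : Set RateParam} {μ : ℕ → RateParam → ℝ}
    (h : IsAdmissible d Θ μ) : ∃ N : Estimator d, ∀ θ ∈ Θ, ∀ L : ℝ, 0 < L →
      ∃ C : ℝ, 0 < C ∧ ∀ᶠ n in atTop,
        maxRisk N n (boundedClass d θ L L) ≤ ENNReal.ofReal (C * μ n θ) := by
  obtain ⟨hpos, N, hN⟩ := h
  refine ⟨N, fun θ hθ L hL => ?_⟩
  obtain ⟨C, hC1, hC2⟩ := ENNReal.lt_iff_exists_nnreal_btwn.mp (hN θ hθ L L hL hL)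
  refine ⟨C + 1, by positivity, ?_⟩
  filter_upwards [eventually_lt_of_limsup_lt hC1, hpos θ hθ] with n hn hμ
  have hμ' : ENNReal.ofReal (μ n θ) ≠ 0 := by simpa using hμ
  rw [ENNReal.div_lt_iff (Or.inl hμ') (Or.inl ENNReal.ofReal_ne_top)] at hn
  rw [ENNReal.ofReal_mul (by positivity)]
  refine hn.le.trans ?_
  gcongr
  rw [ENNReal.ofReal_add (by positivity) zero_le_one, ENNReal.ofReal_coe_nnreal]
  exact le_self_add

/-- For `θ' = θ` this bounds the gain of an admissible normalization at `θ`; if the normalization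
outperforms the rate at `θ`, the first alternative fails and the second bounds it from below at
`θ'`. -/
lemma IsAdmissible.psiStar_le_or {d : ℕ} (hd : 1 ≤ d) {b : ℝ≥0∞} {Θ : Set RateParam}
    {μ : ℕ → RateParam → ℝ} (hμ : IsAdmissible d Θ μ) {θ θ' : RateParam} (hθ : θ ∈ Θ)
    (hθ' : θ' ∈ Θ) (hz : θ ∈ zone₁ d b ∧ θ' ∈ rateParams b ∨ θ ∈ zone₂ d b ∧ θ' ∈ zone₂ d b)
    {ε : ℝ} (hε : 0 < ε) :
    ∃ C : ℝ, 0 < C ∧ ∀ᶠ n : ℕ in atTop,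
      psiStar d n θ ≤ C * μ n θ ∨ psiStar d n θ ≤ C * (n : ℝ) ^ ε * μ n θ' := by
  obtain ⟨κ, L, hκ, hL, hlow⟩ := maxRisk_dichotomy hd hz hε
  obtain ⟨N, hN⟩ := hμ.exists_le
  obtain ⟨C₁, hC₁, h₁⟩ := hN θ hθ L hL
  obtain ⟨C₂, hC₂, h₂⟩ := hN θ' hθ' L hL
  refine ⟨(C₁ + C₂) / κ, by positivity, ?_⟩
  filter_upwards [hlow N, h₁, h₂, hμ.1 θ hθ, hμ.1 θ' hθ', eventually_ge_atTop 1]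
    with n hn h₁n h₂n hμn hμn' hn1
  have hn0 : (0 : ℝ) < n := by exact_mod_cast hn1
  have hnε : 0 < (n : ℝ) ^ ε := Real.rpow_pos_of_pos hn0 ε
  rcases hn with hn | hn
  · left
    have h := (ENNReal.ofReal_le_ofReal_iff (by positivity)).mp (hn.trans h₁n)
    rw [div_mul_eq_mul_div, le_div_iff₀ hκ]
    nlinarith
  · right
    have h := (ENNReal.ofReal_le_ofReal_iff (by positivity)).mp (hn.trans h₂n)
    rw [Real.rpow_neg hn0.le] at h
    rw [div_mul_eq_mul_div, div_mul_eq_mul_div, le_div_iff₀ hκ]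
    have h' : κ * psiStar d n θ ≤ (C₂ * μ n θ') * (n : ℝ) ^ ε := by
      rw [← div_le_iff₀ hnε]
      calc κ * psiStar d n θ / (n : ℝ) ^ ε = κ * ((n : ℝ) ^ ε)⁻¹ * psiStar d n θ := by
            rw [div_eq_mul_inv]
            ring
        _ ≤ _ := h
    have h'' : 0 ≤ C₁ * (n : ℝ) ^ ε * μ n θ' := by positivity
    linarith

/-- The price of outperforming the rate at `θ`: a loss at every `θ'` with a larger exponent, which
dominates the gain at `θ`. -/
theorem tendsto_mul_of_mem_outperformSet {d : ℕ} (hd : 1 ≤ d) {b : ℝ≥0∞} {Θ : Set RateParam}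
    {μ : ℕ → RateParam → ℝ} (hμ : IsAdmissible d Θ μ) {θ θ' : RateParam}
    (hθ : θ ∈ outperformSet Θ (psiStar d) μ) (hθ' : θ' ∈ Θ)
    (hz : θ ∈ zone₁ d b ∧ θ' ∈ rateParams b ∨ θ ∈ zone₂ d b ∧ θ' ∈ zone₂ d b)
    (hlt : rateExponent d θ < rateExponent d θ') :
    Tendsto (fun n => psiStar d n θ' / μ n θ' * (psiStar d n θ / μ n θ)) atTop (𝓝 0) := by
  obtain ⟨hθΘ, hout⟩ := hθ
  set δ : ℝ := rateExponent d θ' - rateExponent d θ with hδ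
  have hδ0 : 0 < δ := sub_pos.mpr hlt
  have hz' : θ ∈ zone₁ d b ∧ θ ∈ rateParams b ∨ θ ∈ zone₂ d b ∧ θ ∈ zone₂ d b :=
    hz.imp (fun h => ⟨h.1, h.1.1⟩) fun h => ⟨h.1, h.1⟩
  obtain ⟨C, hC, h1⟩ := hμ.psiStar_le_or hd hθΘ hθ' hz (ε := δ / 8) (by positivity)
  obtain ⟨C', hC', h2⟩ := hμ.psiStar_le_or hd hθΘ hθΘ hz' (ε := δ / 8) (by positivity)
  have hlim : Tendsto (fun n : ℕ => C * C' * (n : ℝ) ^ (-(δ / 4))) atTop (𝓝 0) := by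
    have := ((tendsto_rpow_neg_atTop (y := δ / 4) (by positivity)).comp
      tendsto_natCast_atTop_atTop).const_mul (C * C')
    simpa using this
  have hpos : ∀ᶠ n : ℕ in atTop,
      0 ≤ psiStar d n θ' / μ n θ' * (psiStar d n θ / μ n θ) := by
    filter_upwards [hμ.1 θ hθΘ, hμ.1 θ' hθ', eventually_ge_atTop 2] with n hn hn' hn2
    have := rateBase_pos hn2
    rw [psiStar_eq, psiStar_eq]
    positivity
  refine tendsto_of_tendsto_of_tendsto_of_le_of_le' tendsto_const_nhds hlim hpos ?_
  filter_upwards [h1, h2, hμ.1 θ hθΘ, hμ.1 θ' hθ', eventually_ge_atTop 2,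
    hout.eventually_gt_atTop C] with n h1n h2n hμn hμn' hn2 houtn
  have hX := rateBase_pos hn2
  have hn0 : (0 : ℝ) < n := by exact_mod_cast (by omega : 0 < n)
  have hn1 : (1 : ℝ) ≤ n := by exact_mod_cast (by omega : 1 ≤ n)
  have hψ : 0 < psiStar d n θ := by rw [psiStar_eq]; positivity
  have hnε : 1 ≤ (n : ℝ) ^ (δ / 8) := Real.one_le_rpow hn1 (by positivity)
  have h3 : psiStar d n θ ≤ C * (n : ℝ) ^ (δ / 8) * μ n θ' := by
    rcases h1n with h | h
    · rw [lt_div_iff₀ hμn] at houtn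
      linarith
    · exact h
  have h4 : psiStar d n θ / μ n θ ≤ C' * (n : ℝ) ^ (δ / 8) := by
    rw [div_le_iff₀ hμn]
    rcases h2n with h | h
    · refine h.trans ?_
      gcongr
      exact le_mul_of_one_le_right hC'.le hnε
    · exact h
  have h5 : psiStar d n θ' = psiStar d n θ * rateBase n ^ δ := by
    rw [psiStar_eq, psiStar_eq, ← Real.rpow_add hX, hδ]
    congr 1
    ring
  have h6 : rateBase n ^ δ ≤ (n : ℝ) ^ (-(δ / 2)) := by
    refine (Real.rpow_le_rpow hX.le (rateBase_le hn2) hδ0.le).trans (le_of_eq ?_)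
    rw [← Real.rpow_mul hn0.le]
    congr 1
    ring
  have h7 : psiStar d n θ' / μ n θ' ≤ C * (n : ℝ) ^ (δ / 8) * (n : ℝ) ^ (-(δ / 2)) := by
    rw [h5, div_le_iff₀ hμn']
    calc psiStar d n θ * rateBase n ^ δ
        ≤ (C * (n : ℝ) ^ (δ / 8) * μ n θ') * (n : ℝ) ^ (-(δ / 2)) := by gcongr
      _ = _ := by ring
  calc psiStar d n θ' / μ n θ' * (psiStar d n θ / μ n θ)
      ≤ C * (n : ℝ) ^ (δ / 8) * (n : ℝ) ^ (-(δ / 2)) * (C' * (n : ℝ) ^ (δ / 8)) := by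
        gcongr
    _ = C * C' * ((n : ℝ) ^ (δ / 8) * (n : ℝ) ^ (-(δ / 2)) * (n : ℝ) ^ (δ / 8)) := by ring
    _ = C * C' * (n : ℝ) ^ (-(δ / 4)) := by
        rw [← Real.rpow_add hn0, ← Real.rpow_add hn0]
        congr 2
        ring

lemma rateExponent_le_of_mem_outperformSet {d : ℕ} (hd : 1 ≤ d) {b : ℝ≥0∞} {Θ : Set RateParam}
    {μ : ℕ → RateParam → ℝ} (hμ : IsAdmissible d Θ μ) {θ θ' : RateParam}
    (hθ : θ ∈ outperformSet Θ (psiStar d) μ) (hθ' : θ' ∈ outperformSet Θ (psiStar d) μ)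
    (hz : θ ∈ zone₁ d b ∧ θ' ∈ rateParams b ∨ θ ∈ zone₂ d b ∧ θ' ∈ zone₂ d b) :
    rateExponent d θ' ≤ rateExponent d θ := by
  by_contra! hlt
  exact not_tendsto_nhds_of_tendsto_atTop (hθ'.2.atTop_mul_atTop₀ hθ.2) 0
    (tendsto_mul_of_mem_outperformSet hd hμ hθ hθ'.1 hz hlt)

/-! ### Level sets of the rate exponent -/

/-- The larger of `1 / r` and `1 - 1 / r`. On the nonparametric regime the exponent is
`β / (β + d * dualIndex r)`. -/
noncomputable def dualIndex (r : ℝ≥0∞) : ℝ := max (invIndex r) (1 - invIndex r)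

lemma two_le_iff_invIndex_le {r : ℝ≥0∞} (hr : 1 ≤ r) : 2 ≤ r ↔ invIndex r ≤ 1 / 2 := by
  have h1 : r⁻¹ ≠ ∞ := ENNReal.inv_ne_top.mpr (one_pos.trans_le hr).ne'
  rw [invIndex, ← ENNReal.inv_le_inv, ← ENNReal.toReal_le_toReal h1 (by simp)]
  norm_num

lemma eq_two_of_invIndex_eq {r : ℝ≥0∞} (h : invIndex r = 1 / 2) : r = 2 := by
  rw [invIndex, ENNReal.toReal_inv, one_div, inv_inj] at h
  have h2 : r ≠ ∞ := by
    rintro rfl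
    simp at h
  rw [← ENNReal.ofReal_toReal h2, h]
  norm_num

lemma half_le_dualIndex (r : ℝ≥0∞) : 1 / 2 ≤ dualIndex r := by
  unfold dualIndex
  rcases le_total (invIndex r) (1 / 2) with h | h
  · exact le_max_of_le_right (by linarith)
  · exact le_max_of_le_left h

lemma dualIndex_of_two_le {r : ℝ≥0∞} (hr : 2 ≤ r) : dualIndex r = 1 - invIndex r := by
  have := (two_le_iff_invIndex_le (one_le_two.trans hr)).mp hr
  exact max_eq_right (by linarith)

lemma dualIndex_of_lt_two {r : ℝ≥0∞} (hr1 : 1 ≤ r) (hr : r < 2) : dualIndex r = invIndex r := by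
  have := mt (two_le_iff_invIndex_le hr1).mpr (not_le.mpr hr)
  exact max_eq_left (by linarith)

lemma mem_nonparametric_iff {d : ℕ} {b : ℝ≥0∞} {θ : RateParam} :
    θ ∈ nonparametric d b ↔ θ ∈ rateParams b ∧ θ.1 < d * dualIndex θ.2 ∧
      ¬ (ENNReal.ofReal θ.1 = b ∧ θ.2 = 2) := by
  constructor
  · rintro ⟨⟨h1, h2, h3⟩ | ⟨h1, h2, h3⟩, h4⟩
    · exact ⟨h1, by rwa [dualIndex_of_two_le h2], h4⟩
    · exact ⟨h1, by rwa [dualIndex_of_lt_two h1.2.2 h2], h4⟩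
  · rintro ⟨h1, h2, h4⟩
    refine ⟨?_, h4⟩
    rcases le_or_gt 2 θ.2 with h | h
    · exact Or.inl ⟨h1, h, by rwa [dualIndex_of_two_le h] at h2⟩
    · exact Or.inr ⟨h1, h, by rwa [dualIndex_of_lt_two h1.2.2 h] at h2⟩

/-- The ratio of `β` to its critical value. -/
noncomputable def criticalRatio (d : ℕ) (θ : RateParam) : ℝ := θ.1 / (d * dualIndex θ.2)

section Level

variable {d : ℕ} {b : ℝ≥0∞} {θ θ' : RateParam}

lemma mul_dualIndex_pos (hd : 1 ≤ d) (r : ℝ≥0∞) : 0 < d * dualIndex r := by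
  have h1 : (0 : ℝ) < d := by exact_mod_cast hd
  have h2 := half_le_dualIndex r
  exact mul_pos h1 (by linarith)

lemma criticalRatio_pos (hd : 1 ≤ d) (hθ : θ ∈ nonparametric d b) : 0 < criticalRatio d θ :=
  div_pos (mem_nonparametric_iff.mp hθ).1.1 (mul_dualIndex_pos hd _)

lemma criticalRatio_lt_one (hd : 1 ≤ d) (hθ : θ ∈ nonparametric d b) : criticalRatio d θ < 1 :=
  (div_lt_one (mul_dualIndex_pos hd _)).mpr (mem_nonparametric_iff.mp hθ).2.1

lemma criticalRatio_mul (hd : 1 ≤ d) (θ : RateParam) :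
    criticalRatio d θ * (d * dualIndex θ.2) = θ.1 :=
  div_mul_cancel₀ _ (mul_dualIndex_pos hd _).ne'

lemma rateExponent_eq (hd : 1 ≤ d) (hθ : θ ∈ nonparametric d b) :
    rateExponent d θ = 1 - (criticalRatio d θ + 1)⁻¹ := by
  have hq := criticalRatio_pos hd hθ
  have h0 := mul_dualIndex_pos hd θ.2
  obtain ⟨h1, h2, -⟩ := mem_nonparametric_iff.mp hθ
  have h3 : rateExponent d θ = θ.1 / (θ.1 + d * dualIndex θ.2) := by
    unfold rateExponent
    split_ifs with h4 h5 h5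
    · rw [dualIndex_of_two_le h4]
    · rw [dualIndex_of_two_le h4] at h2
      exact absurd h2 h5
    · rw [dualIndex_of_lt_two h1.2.2 (not_le.mp h4)]
    · rw [dualIndex_of_lt_two h1.2.2 (not_le.mp h4)] at h2
      exact absurd h2 h5
  have h6 := h1.1
  rw [h3, criticalRatio]
  generalize (d : ℝ) * dualIndex θ.2 = m at h0
  field_simp
  ring

lemma rateExponent_lt_iff (hd : 1 ≤ d) (hθ : θ ∈ nonparametric d b)
    (hθ' : θ' ∈ nonparametric d b) :
    rateExponent d θ < rateExponent d θ' ↔ criticalRatio d θ < criticalRatio d θ' := by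
  have h1 := criticalRatio_pos hd hθ
  have h2 := criticalRatio_pos hd hθ'
  rw [rateExponent_eq hd hθ, rateExponent_eq hd hθ', sub_lt_sub_iff_left,
    inv_lt_inv₀ (by positivity) (by positivity)]
  constructor <;> intro h <;> linarith

/-- As the corner `(b, 2)` is left out, the level set through `θ` meets the line `r = 2` strictly
below `b`. -/
lemma ofReal_half_mul_lt (hd : 1 ≤ d) (hθ : θ ∈ nonparametric d b) :
    ENNReal.ofReal (criticalRatio d θ * (d * (1 / 2))) < b := by
  obtain ⟨h1, h2, h3⟩ := mem_nonparametric_iff.mp hθ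
  have hq := criticalRatio_pos hd hθ
  have hdR : (0 : ℝ) < d := by exact_mod_cast hd
  have hle := half_le_dualIndex θ.2
  have hβ := criticalRatio_mul hd θ
  refine lt_of_le_of_ne ((ENNReal.ofReal_le_ofReal ?_).trans h1.2.1) fun heq => h3 ?_
  · rw [← hβ]
    gcongr
  · have h4 : ENNReal.ofReal θ.1 ≤ ENNReal.ofReal (criticalRatio d θ * (d * (1 / 2))) := by
      rw [heq]
      exact h1.2.1
    rw [ENNReal.ofReal_le_ofReal_iff (by positivity)] at h4
    nth_rewrite 1 [← hβ] at h4
    have h5 : dualIndex θ.2 ≤ 1 / 2 := by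
      have := le_of_mul_le_mul_left h4 hq
      exact le_of_mul_le_mul_left this hdR
    have h6 : invIndex θ.2 = 1 / 2 := by
      have h7 := (le_max_left _ _).trans h5
      have h8 := (le_max_right _ _).trans h5
      linarith
    refine ⟨?_, eq_two_of_invIndex_eq h6⟩
    rw [← heq, ← hβ, le_antisymm h5 hle]

/-- The point at `1 / r = s` of the level curve with ratio `q`. -/
noncomputable def levelPoint (d : ℕ) (q s : ℝ) : RateParam :=
  (q * (d * max s (1 - s)), (ENNReal.ofReal s)⁻¹)

lemma continuous_levelPoint (d : ℕ) (q : ℝ) : Continuous (levelPoint d q) := by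
  unfold levelPoint
  refine Continuous.prodMk (by fun_prop) ?_
  exact continuous_inv.comp ENNReal.continuous_ofReal

lemma invIndex_levelPoint {q s : ℝ} (hs : 0 ≤ s) : invIndex (levelPoint d q s).2 = s := by
  simp [invIndex, levelPoint, hs]

lemma dualIndex_levelPoint {q s : ℝ} (hs : 0 ≤ s) :
    dualIndex (levelPoint d q s).2 = max s (1 - s) := by
  rw [dualIndex, invIndex_levelPoint hs]

lemma levelPoint_invIndex (hd : 1 ≤ d) (hr : 1 ≤ θ.2) :
    levelPoint d (criticalRatio d θ) (invIndex θ.2) = θ := by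
  have h1 : θ.2⁻¹ ≠ ∞ := ENNReal.inv_ne_top.mpr (one_pos.trans_le hr).ne'
  refine Prod.ext (criticalRatio_mul hd θ) ?_
  simp only [levelPoint, invIndex]
  rw [ENNReal.ofReal_toReal h1, inv_inv]

/-- The level set of the exponent through a parameter is an arc. -/
lemma exists_arc_eq_levelSet (hd : 1 ≤ d) (hθ : θ ∈ nonparametric d b) :
    ∃ x y : ℝ, x < y ∧ ∃ γ : Set.Icc x y → RateParam, Continuous γ ∧ Function.Injective γ ∧
      Set.range γ = {θ' | θ' ∈ nonparametric d b ∧ rateExponent d θ' = rateExponent d θ} := by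
  have hdR : (0 : ℝ) < d := by exact_mod_cast hd
  set q := criticalRatio d θ with hq
  have hq0 : 0 < q := criticalRatio_pos hd hθ
  have hq1 : q < 1 := criticalRatio_lt_one hd hθ
  have hhalf := ofReal_half_mul_lt hd hθ
  rw [← hq] at hhalf
  -- the largest value of `max s (1 - s)` on the arc
  obtain ⟨τ, hτ, hτ1, hτb⟩ : ∃ τ : ℝ, 1 / 2 < τ ∧ τ ≤ 1 ∧
      ∀ m : ℝ, m ≤ 1 → (ENNReal.ofReal (q * (d * m)) ≤ b ↔ m ≤ τ) := by
    rcases eq_or_ne b ∞ with rfl | hb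
    · exact ⟨1, by norm_num, le_rfl, fun m hm => by simp [hm]⟩
    · have h1 : q * (d * (1 / 2)) < b.toReal := by
        rwa [ENNReal.ofReal_lt_iff_lt_toReal (by positivity) hb] at hhalf
      refine ⟨min 1 (b.toReal / (q * d)), lt_min (by norm_num) ?_, min_le_left _ _, fun m hm => ?_⟩
      · rw [lt_div_iff₀ (by positivity)]
        linarith
      · rw [ENNReal.ofReal_le_iff_le_toReal hb, le_min_iff, le_div_iff₀ (by positivity)]
        constructor
        · exact fun h => ⟨hm, by linarith⟩
        · rintro ⟨-, h⟩
          linarith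
  refine ⟨1 - τ, τ, by linarith, fun s => levelPoint d q s,
    (continuous_levelPoint d q).comp continuous_subtype_val, ?_, ?_⟩
  · intro s t hst
    have h1 : (0 : ℝ) ≤ s := by linarith [s.2.1]
    have h2 : (0 : ℝ) ≤ t := by linarith [t.2.1]
    refine Subtype.ext ?_
    rw [← invIndex_levelPoint (d := d) (q := q) h1, ← invIndex_levelPoint (d := d) (q := q) h2]
    exact congrArg (fun θ => invIndex θ.2) hst
  · ext θ'
    constructor
    · rintro ⟨⟨s, hs1, hs2⟩, rfl⟩
      have hs0 : 0 ≤ s := by linarith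
      have hm : max s (1 - s) ≤ τ := max_le hs2 (by linarith)
      have hm0 : 1 / 2 ≤ max s (1 - s) := by
        rcases le_total s (1 / 2) with h | h
        · exact le_max_of_le_right (by linarith)
        · exact le_max_of_le_left h
      have hm0' : 0 < max s (1 - s) := by linarith
      have hmem : levelPoint d q s ∈ nonparametric d b := by
        refine mem_nonparametric_iff.mpr ⟨⟨?_, ?_, ?_⟩, ?_, ?_⟩
        · simp only [levelPoint]
          positivity
        · exact (hτb _ (hm.trans hτ1)).mpr hm
        · simp only [levelPoint]
          rw [ENNReal.one_le_inv]
          exact ENNReal.ofReal_le_one.mpr (hs2.trans hτ1)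
        · rw [dualIndex_levelPoint hs0]
          exact mul_lt_of_lt_one_left (by positivity) hq1
        · rintro ⟨h1, h2⟩
          have h3 := invIndex_levelPoint (d := d) (q := q) hs0
          rw [h2] at h3
          have h4 : s = 1 / 2 := by rw [← h3]; simp [invIndex]
          have h5 : max s (1 - s) = 1 / 2 := by rw [h4]; norm_num
          simp only [levelPoint, h5] at h1
          exact hhalf.ne h1
      refine ⟨hmem, ?_⟩
      have h6 : criticalRatio d (levelPoint d q s) = q := by
        rw [criticalRatio, dualIndex_levelPoint hs0]
        exact mul_div_cancel_right₀ _ (by positivity)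
      rw [rateExponent_eq hd hmem, rateExponent_eq hd hθ, h6]
    · rintro ⟨hθ', heq⟩
      have hq' : criticalRatio d θ' = q := by
        have h1 := (rateExponent_lt_iff hd hθ hθ').not.mp heq.symm.not_lt
        have h2 := (rateExponent_lt_iff hd hθ' hθ).not.mp heq.not_lt
        exact le_antisymm (not_lt.mp h1) (not_lt.mp h2)
      obtain ⟨⟨h1, h2, h3⟩, -, -⟩ := mem_nonparametric_iff.mp hθ'
      have h4 := invIndex_nonneg θ'.2
      have h5 := invIndex_le_one h3
      have h6 : dualIndex θ'.2 ≤ τ := by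
        refine (hτb _ (max_le h5 (by linarith))).mp ?_
        rw [← hq']
        exact (criticalRatio_mul hd θ').symm ▸ h2
      refine ⟨⟨invIndex θ'.2, ?_, (le_max_left _ _).trans h6⟩, ?_⟩
      · linarith [(le_max_right (invIndex θ'.2) (1 - invIndex θ'.2)).trans h6]
      · simp only
        rw [← hq', levelPoint_invIndex hd h3]

lemma isCurve_range {X : Type*} [TopologicalSpace X] [CompactSpace X]
    [ChartedSpace (EuclideanHalfSpace 1) X] {f : X → RateParam} (hf : Continuous f)
    (hi : Function.Injective f) : IsCurve (Set.range f) :=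
  ⟨((hf.isClosedEmbedding hi).isEmbedding.toHomeomorph).chartedSpace⟩

lemma isCurve_empty : IsCurve ∅ :=
  ⟨{ atlas := ∅
     chartAt := fun x => x.2.elim
     mem_chart_source := fun x => x.2.elim
     chart_mem_atlas := fun x => x.2.elim }⟩

/-- Two level sets of the exponent coincide or are disjoint arcs. -/
lemma isCurve_union_levelSet (hd : 1 ≤ d) (hθ : θ ∈ nonparametric d b)
    (hθ' : θ' ∈ nonparametric d b) :
    IsCurve ({η | η ∈ nonparametric d b ∧ rateExponent d η = rateExponent d θ} ∪
      {η | η ∈ nonparametric d b ∧ rateExponent d η = rateExponent d θ'}) := by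
  obtain ⟨x, y, hxy, γ, hγ, hγi, hγr⟩ := exists_arc_eq_levelSet hd hθ
  obtain ⟨x', y', hxy', γ', hγ', hγi', hγr'⟩ := exists_arc_eq_levelSet hd hθ'
  have : Fact (x < y) := ⟨hxy⟩
  have : Fact (x' < y') := ⟨hxy'⟩
  by_cases heq : rateExponent d θ = rateExponent d θ'
  · rw [heq, Set.union_self, ← hγr']
    exact isCurve_range hγ' hγi'
  · rw [← hγr, ← hγr', ← Set.Sum.elim_range]
    refine isCurve_range (hγ.sumElim hγ') (hγi.sumElim hγi' fun s t hst => heq ?_)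
    have h1 : γ s ∈ Set.range γ := ⟨s, rfl⟩
    have h2 : γ' t ∈ Set.range γ' := ⟨t, rfl⟩
    rw [hγr] at h1
    rw [hγr'] at h2
    rw [← h1.2, ← h2.2, hst]

lemma zone₂_subset_nonparametric : zone₂ d b ⊆ nonparametric d b :=
  fun _ h => ⟨Or.inr h, fun h' => h.2.1.ne h'.2⟩

/-- Near the point of the second zone where `r` approaches `2` and `β` its largest value, the
exponent exceeds its value at a given parameter. -/
lemma containsBall_of_mem_nonparametric (hd : 1 ≤ d) (hθ : θ ∈ nonparametric d b) :
    ContainsBall {θ' | θ' ∈ zone₂ d b ∧ rateExponent d θ < rateExponent d θ'} := by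
  have hdR : (0 : ℝ) < d := by exact_mod_cast hd
  set q := criticalRatio d θ with hq
  have hq0 : 0 < q := criticalRatio_pos hd hθ
  have hq1 : q < 1 := criticalRatio_lt_one hd hθ
  have hhalf := ofReal_half_mul_lt hd hθ
  rw [← hq] at hhalf
  have hhalf' : ENNReal.ofReal (q * (d * (1 / 2))) < ENNReal.ofReal (d * (1 / 2)) := by
    rw [ENNReal.ofReal_lt_ofReal_iff (by positivity)]
    exact mul_lt_of_lt_one_left (by positivity) hq1
  obtain ⟨B, hB1, hB2⟩ := exists_between (lt_min hhalf hhalf')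
  have hBt : B ≠ ∞ := (hB2.trans_le le_top).ne
  set β₀ := B.toReal with hβ₀
  have hBβ : ENNReal.ofReal β₀ = B := ENNReal.ofReal_toReal hBt
  rw [← hBβ] at hB1 hB2
  obtain ⟨hβb, hβd⟩ := lt_min_iff.mp hB2
  have h1 : q * (d * (1 / 2)) < β₀ := (ENNReal.ofReal_lt_ofReal_iff_of_nonneg (by positivity)).mp hB1
  have hβ0 : 0 < β₀ := lt_trans (by positivity) h1
  have h2 : β₀ < d * (1 / 2) := (ENNReal.ofReal_lt_ofReal_iff_of_nonneg hβ0.le).mp hβd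
  obtain ⟨r₀, hr1, hr2⟩ := exists_between
    (max_lt one_lt_two ((div_lt_iff₀ hβ0).mpr (by linarith) : q * d / β₀ < 2))
  obtain ⟨hr1, hr1'⟩ := max_lt_iff.mp hr1
  rw [div_lt_iff₀ hβ0] at hr1'
  let U : Set (ℝ × ℝ) := {v | 0 < v.1} ∩ {v | ENNReal.ofReal v.1 < b} ∩ {v | 1 < v.2} ∩
    {v | v.2 < 2} ∩ {v | q * d < v.2 * v.1} ∩ {v | v.2 * v.1 < d}
  have hU : IsOpen U := by
    refine IsOpen.inter (IsOpen.inter (IsOpen.inter (IsOpen.inter (IsOpen.inter ?_ ?_) ?_) ?_) ?_) ?_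
    · exact isOpen_lt continuous_const continuous_fst
    · exact isOpen_lt (ENNReal.continuous_ofReal.comp continuous_fst) continuous_const
    · exact isOpen_lt continuous_const continuous_snd
    · exact isOpen_lt continuous_snd continuous_const
    · exact isOpen_lt continuous_const (continuous_snd.mul continuous_fst)
    · exact isOpen_lt (continuous_snd.mul continuous_fst) continuous_const
  have hmem : (β₀, r₀) ∈ U :=
    ⟨⟨⟨⟨⟨hβ0, hβb⟩, hr1⟩, hr2⟩, hr1'⟩, by simp only [Set.mem_ofPred_eq]; nlinarith⟩
  obtain ⟨ε, hε, hball⟩ := Metric.isOpen_iff.mp hU _ hmem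
  refine ⟨β₀, r₀, ε, hε, fun β r hβr => ?_⟩
  have hin : (β, r) ∈ Metric.ball (β₀, r₀) ε := by
    rw [Metric.mem_ball, Prod.dist_eq, Real.dist_eq, Real.dist_eq]
    refine max_lt ?_ ?_
    · exact abs_lt_of_sq_lt_sq (by nlinarith [sq_nonneg (r - r₀)]) hε.le
    · exact abs_lt_of_sq_lt_sq (by nlinarith [sq_nonneg (β - β₀)]) hε.le
  obtain ⟨⟨⟨⟨⟨k1, k2⟩, k3⟩, k4⟩, k5⟩, k6⟩ := hball hin
  simp only [Set.mem_ofPred_eq] at k1 k2 k3 k4 k5 k6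
  have hr0 : 0 < r := by linarith
  have hinv : invIndex (ENNReal.ofReal r) = r⁻¹ := by
    rw [invIndex, ENNReal.toReal_inv, ENNReal.toReal_ofReal hr0.le]
  have hlt2 : ENNReal.ofReal r < 2 := by
    rw [ENNReal.ofReal_lt_iff_lt_toReal hr0.le ENNReal.ofNat_ne_top]
    simpa using k4
  have hone : 1 ≤ ENNReal.ofReal r := ENNReal.one_le_ofReal.mpr k3.le
  have hz : (β, ENNReal.ofReal r) ∈ zone₂ d b := by
    refine ⟨⟨k1, k2.le, hone⟩, hlt2, ?_⟩
    simp only [hinv]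
    rw [← div_eq_mul_inv, lt_div_iff₀ hr0]
    linarith
  refine ⟨hr0.le, hz, (rateExponent_lt_iff hd hθ (zone₂_subset_nonparametric hz)).mpr ?_⟩
  rw [criticalRatio, criticalRatio, dualIndex_of_lt_two hone hlt2, hinv] at *
  rw [← hq, lt_div_iff₀ (by positivity), ← div_eq_mul_inv, mul_div_assoc', div_lt_iff₀ hr0]
  linarith

end Level

/-! ### The adaptive rate -/

theorem isAdaptiveRate_psiStar {d : ℕ} (hd : 1 ≤ d) {b : ℝ≥0∞}
    (hadm : IsAdmissible d (nonparametric d b) (psiStar d)) :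
    IsAdaptiveRate d (nonparametric d b) (psiStar d) := by
  refine ⟨hadm, fun μ hμ => ?_, fun μ hμ θ hθ => ?_⟩
  · set O := outperformSet (nonparametric d b) (psiStar d) μ with hO
    rcases O.eq_empty_or_nonempty with he | ⟨θ₀, hθ₀⟩
    · exact ⟨∅, Set.empty_subset _, isCurve_empty, he.subset⟩
    -- within each zone, all outperformed parameters have the same exponent
    have h1 : ∃ θ ∈ nonparametric d b, ∀ θ' ∈ O, θ' ∈ zone₁ d b →
        rateExponent d θ' = rateExponent d θ := by
      by_cases h : ∃ θ ∈ O, θ ∈ zone₁ d b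
      · obtain ⟨θ, hθ, hz⟩ := h
        exact ⟨θ, hθ.1, fun θ' hθ' hz' => le_antisymm
          (rateExponent_le_of_mem_outperformSet hd hμ hθ hθ' (Or.inl ⟨hz, hz'.1⟩))
          (rateExponent_le_of_mem_outperformSet hd hμ hθ' hθ (Or.inl ⟨hz', hz.1⟩))⟩
      · exact ⟨θ₀, hθ₀.1, fun θ' hθ' hz' => absurd ⟨θ', hθ', hz'⟩ h⟩
    have h2 : ∃ θ ∈ nonparametric d b, ∀ θ' ∈ O, θ' ∈ zone₂ d b →
        rateExponent d θ' = rateExponent d θ := by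
      by_cases h : ∃ θ ∈ O, θ ∈ zone₂ d b
      · obtain ⟨θ, hθ, hz⟩ := h
        exact ⟨θ, hθ.1, fun θ' hθ' hz' => le_antisymm
          (rateExponent_le_of_mem_outperformSet hd hμ hθ hθ' (Or.inr ⟨hz, hz'⟩))
          (rateExponent_le_of_mem_outperformSet hd hμ hθ' hθ (Or.inr ⟨hz', hz⟩))⟩
      · exact ⟨θ₀, hθ₀.1, fun θ' hθ' hz' => absurd ⟨θ', hθ', hz'⟩ h⟩
    obtain ⟨θ₁, hθ₁, h1⟩ := h1
    obtain ⟨θ₂, hθ₂, h2⟩ := h2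
    refine ⟨_, ?_, isCurve_union_levelSet hd hθ₁ hθ₂, fun θ hθ => ?_⟩
    · exact Set.union_subset (fun _ h => h.1) fun _ h => h.1
    · exact hθ.1.1.imp (fun hz => ⟨hθ.1, h1 θ hθ hz⟩) fun hz => ⟨hθ.1, h2 θ hθ hz⟩
  · refine ⟨_, fun θ' h => zone₂_subset_nonparametric h.1,
      containsBall_of_mem_nonparametric hd hθ.1, fun θ' hθ' => ?_⟩
    exact tendsto_mul_of_mem_outperformSet hd hμ hθ (zone₂_subset_nonparametric hθ'.1)
      (hθ.1.1.imp (fun hz => ⟨hz, hθ'.1.1⟩) fun hz => ⟨hz, hθ'.1⟩) hθ'.2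

end L2NormEstimation

theorem theorem5 (d : ℕ) (hd : 1 ≤ d) (b : ℝ≥0∞) (hb : 0 < b)
    (hadm : L2NormEstimation.IsAdmissible d (L2NormEstimation.nonparametric d b)
      (L2NormEstimation.psiStar d)) :
    L2NormEstimation.IsAdaptiveRate d (L2NormEstimation.nonparametric d b)
      (L2NormEstimation.psiStar d) :=
  L2NormEstimation.isAdaptiveRate_psiStar hd hadm
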